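/- **Model.** Let $\mathbb S$ be a finite state space, $\mathbb A=\{0,1\}$, $P(s,a,s')$ a transition kernel, $r:\mathbb S\times\mathbb A\to\mathbb R$ a reward function, $r_{\max}=\max_{s,a}|r(s,a)|$, $0<\alpha<1$, $\beta=\min\{\alpha,1-\alpha\}$, and let $N\ge 1$ be such that $\alpha N$ is an integer. In the $N$-armed restless bandit problem a policy (randomized, possibly history-dependent) chooses at each time $t$ an action vector $(A_t(i))_{i\in[N]}\in\{0,1\}^N$ with $\sum_i A_t(i)=\alpha N$; given the past, the arm states $S_t(i)$ then move independently according to $P(S_t(i),A_t(i),\cdot)$. For an initial state vector $S_0$ let $R^-(\pi,S_0)=\liminf_{T\to\infty}\frac1T\sum_{t<T}\frac1N\sum_i\mathbb E[r(S_t(i),A_t(i))]$, let $R(\pi,S_0)$ be the corresponding limit if it exists, and let $R^*(N,S_0)=\sup_\pi R^-(\pi,S_0)$. **Optimal single-armed policy.** Let $y^*$ be an optimal solution of the linear program: maximize $\sum_{s,a}r(s,a)y(s,a)$ subject to $\sum_s y(s,1)=\alpha$, $\sum_{s',a}y(s',a)P(s',a,s)=\sum_a y(s,a)$ for all $s$,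 $\sum_{s,a}y(s,a)=1$, $y\ge0$. Let $\bar\pi^*(a|s)=y^*(s,a)/(y^*(s,0)+y^*(s,1))$ if the denominator is positive, and $\bar\pi^*(a|s)=1/2$ otherwise, and let $P_{\bar\pi^*}(s,s')=\sum_a\bar\pi^*(a|s)P(s,a,s')$. Assume that $P_{\bar\pi^*}$ is an aperiodic unichain (a single recurrent class, which is aperiodic, and possibly some transient states), and let $\mu^*$ be its stationary distribution. Let $\Xi$ be the matrix all of whose rows are $\mu^*$, let $W=\sum_{k\ge0}(P_{\bar\pi^*}-\Xi)^k(P_{\bar\pi^*}^\top-\Xi^\top)^k$, let $\lambda_W$ be its largest eigenvalue, $\|v\|_W=\sqrt{vWv^\top}$, and $L_W=2\lambda_W^{1/2}$. **Policy.** For $D\subseteq[N]$ let $m(D)=|D|/N$, let $X_t(D)=\big(\frac1N|\{i\in D:S_t(i)=s\}|\big)_{s\in\mathbb S}$, $h_W(X_t,D)=\|X_t(D)-m(D)\mu^*\|_W$ and $\delta(X_t,D)=\beta(1-m(D))-\frac12\|X_t(D)-m(D)\mu^*\|_1$. The set-optimization policy does the following at each time $t$. 1. It picks $D_t$ uniformly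 at random among the inclusion-maximal minimizers of $h_W(X_t,D)+L_W(1-m(D))$ over all $D\subseteq[N]$ with $\delta(X_t,D)\ge0$. 2. It samples ideal actions $\hat A_t(i)\sim\bar\pi^*(\cdot|S_t(i))$ independently for $i\in[N]$. 3. If $\sum_{i\in D_t}\hat A_t(i)\ge\alpha N$, it pulls $\alpha N$ arms chosen uniformly among the $i\in D_t$ with $\hat A_t(i)=1$, and no others. Otherwise, if $\sum_{i\in D_t}\hat A_t(i)\le\alpha N-(N-|D_t|)$, it leaves idle $(1-\alpha)N$ arms chosen uniformly among the $i\in D_t$ with $\hat A_t(i)=0$, and pulls all others. Otherwise it sets $A_t(i)=\hat A_t(i)$ for all $i\in D_t$ and for as many $i\notin D_t$ as the budget constraint allows, ties being broken uniformly at random. **Theorem.** Under the set-optimization policy $\pi$ the scaled state-count vector $X_t([N])$ is a time-homogeneous Markov chain, with a transition kernel that does not depend on the initial state vector. Moreover, for every initial state vector $S_0$ the long-run average reward $R(\pi,S_0)$ exists, and $$R^*(N,S_0)-R(\pi,S_0)\;\le\;\frac{252\,r_{\max}\,\lambda_W^2\,|\mathbb S|^2}{\beta^2}\cdot\frac1{\sqrt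 N}.$$ -/

import Mathlib

open Filter Topology

/-- The model parameters of a restless bandit: the single-armed MDP with finite state space `S`,
action space `{0, 1}` (encoded as `false`, `true`; `true` = pull the arm), transition kernel `P`
and reward `r`, together with the fraction `α ∈ (0, 1)` of arms to be pulled at every step. -/
structure BanditModel (S : Type*) where
  P : S → Bool → PMF S
  r : S → Bool → ℝ
  α : ℝ
  α_pos : 0 < α
  α_lt_one : α < 1

/-- State vectors of the `N`-armed system. -/
abbrev StateVec (S : Type*) (N : ℕ) := Fin N → S

/-- Action vectors of the `N`-armed system. -/
abbrev ActionVec (N : ℕ) := Fin N → Bool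

/-- The joint law of independent coordinates with laws `p i`. -/
noncomputable def indepLaw {N : ℕ} {A : Type*} [Fintype A] (p : Fin N → PMF A) :
    PMF (Fin N → A) :=
  PMF.ofFintype (fun a => ∏ i, p i (a i)) (by
    classical
    have h := Finset.prod_univ_sum (fun _ : Fin N => (Finset.univ : Finset A)) (fun i a => p i a)
    rw [Fintype.piFinset_univ] at h
    rw [← h]
    refine Finset.prod_eq_one fun i _ => ?_
    have h1 := (p i).tsum_coe
    rwa [tsum_fintype] at h1)

/-! ### Markov chains on a finite state space -/

section Chains

variable {S : Type*} [Fintype S] [DecidableEq S]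

/-- State `j` is accessible from state `i`. -/
def Accessible (Q : Matrix S S ℝ) (i j : S) : Prop := ∃ n : ℕ, 0 < (Q ^ n) i j

/-- Recurrence of a state of a finite-state chain: one can return from wherever one can go. -/
def IsRecurrentState (Q : Matrix S S ℝ) (i : S) : Prop :=
  ∀ j, Accessible Q i j → Accessible Q j i

/-- A single recurrent class, and possibly some transient states. -/
def IsUnichain (Q : Matrix S S ℝ) : Prop :=
  (∃ i, IsRecurrentState Q i) ∧
    ∀ i j, IsRecurrentState Q i → IsRecurrentState Q j → Accessible Q i j

/-- Every recurrent state has period one: the possible return times have no common divisor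
other than `1`. -/
def IsAperiodicChain (Q : Matrix S S ℝ) : Prop :=
  ∀ i, IsRecurrentState Q i → ∀ d : ℕ, (∀ n : ℕ, 0 < n → 0 < (Q ^ n) i i → d ∣ n) → d = 1

def IsAperiodicUnichain (Q : Matrix S S ℝ) : Prop := IsUnichain Q ∧ IsAperiodicChain Q

/-- `μ` is a stationary probability distribution of `Q` (as a row vector). -/
def IsStationaryDist (Q : Matrix S S ℝ) (μ : S → ℝ) : Prop :=
  (∀ s, 0 ≤ μ s) ∧ ∑ s, μ s = 1 ∧ Matrix.vecMul μ Q = μ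

/-- The matrix all of whose rows are `μ`. -/
def rowConst (μ : S → ℝ) : Matrix S S ℝ := Matrix.of fun _ s' => μ s'

/-- `W = ∑ₖ (Q - Ξ)ᵏ (Qᵀ - Ξᵀ)ᵏ`, where all rows of `Ξ` equal `μ`. -/
noncomputable def weightMatrix (Q : Matrix S S ℝ) (μ : S → ℝ) : Matrix S S ℝ :=
  ∑' k : ℕ, (Q - rowConst μ) ^ k * (Q.transpose - (rowConst μ).transpose) ^ k

/-- The largest eigenvalue of `W`. -/
noncomputable def lambdaW (Q : Matrix S S ℝ) (μ : S → ℝ) : ℝ :=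
  sSup {c : ℝ | Module.End.HasEigenvalue (Matrix.toLin' (weightMatrix Q μ)) c}

/-- `‖v‖_W = √(v W vᵀ)`. -/
noncomputable def weightedNorm (W : Matrix S S ℝ) (v : S → ℝ) : ℝ :=
  Real.sqrt (v ⬝ᵥ (W.mulVec v))

end Chains

/-! ### Scaled state counts -/

section Counts

variable {S : Type*} [DecidableEq S] {N : ℕ}

/-- `m(D) = |D| / N`. -/
noncomputable def fraction (D : Finset (Fin N)) : ℝ := (D.card : ℝ) / N

/-- The scaled state-count vector on `D`: `x(D, z) = (1/N) ∑_{i ∈ D} 1{s i = z}`. -/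
noncomputable def stateCount (s : StateVec S N) (D : Finset (Fin N)) : S → ℝ :=
  fun z => ((D.filter fun i => s i = z).card : ℝ) / N

end Counts

/-! ### Action rectification -/

section Rectification

variable {N : ℕ}

/-- The number of pulled arms. -/
def pulls (a : ActionVec N) : ℕ := (Finset.univ.filter fun i => a i = true).card

/-- Action vectors that pull `b` arms and take the ideal action on `D`. -/
def completions (b : ℕ) (D : Finset (Fin N)) (ideal : ActionVec N) : Finset (ActionVec N) :=
  Finset.univ.filter fun a => pulls a = b ∧ ∀ i ∈ D, a i = ideal i

/-- The number of arms outside `D` taking their ideal action. -/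
def matchesOutside (D : Finset (Fin N)) (ideal a : ActionVec N) : ℕ :=
  (Finset.univ.filter fun i => i ∉ D ∧ a i = ideal i).card

/-- The action vectors among which the rectification step chooses uniformly, for budget `b`, focus
set `D` and ideal actions `ideal`:
* if at least `b` arms of `D` have ideal action `1`, then exactly `b` of those are pulled;
* else, if at least `N - b` arms of `D` have ideal action `0`, then exactly `N - b` of those are
  not pulled and all others are pulled;
* else all arms of `D` take their ideal actions, and as many of the others as possible. -/
def rectified (b : ℕ) (D : Finset (Fin N)) (ideal : ActionVec N) : Finset (ActionVec N) :=
  if b ≤ (D.filter fun i => ideal i = true).card then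
    Finset.univ.filter fun a => pulls a = b ∧ ∀ i, a i = true → i ∈ D ∧ ideal i = true
  else if (D.filter fun i => ideal i = true).card + N ≤ b + D.card then
    Finset.univ.filter fun a => pulls a = b ∧ ∀ i, a i = false → i ∈ D ∧ ideal i = false
  else
    (completions b D ideal).filter fun a =>
      ∀ a' ∈ completions b D ideal, matchesOutside D ideal a' ≤ matchesOutside D ideal a

theorem pulls_decide (T : Finset (Fin N)) : pulls (fun i => decide (i ∈ T)) = T.card := by
  simp [pulls]

theorem rectified_nonempty {b : ℕ} (hb : b ≤ N) (D : Finset (Fin N)) (ideal : ActionVec N) :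
    (rectified b D ideal).Nonempty := by
  classical
  unfold rectified
  have hsplit := Finset.card_filter_add_card_filter_not (s := D) (fun i => ideal i = true)
  split_ifs with h1 h2
  · obtain ⟨T, hT, hc⟩ := Finset.exists_subset_card_eq h1
    refine ⟨fun i => decide (i ∈ T), ?_⟩
    simp only [Finset.mem_filter, Finset.mem_univ, true_and, pulls_decide, hc, decide_eq_true_eq]
    intro i hi
    simpa using hT hi
  · have h3 : N - b ≤ (D.filter fun i => ¬ ideal i = true).card := by omega
    obtain ⟨T, hT, hc⟩ := Finset.exists_subset_card_eq h3
    have hcT : (Tᶜ).card = b := by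
      rw [Finset.card_compl, hc, Fintype.card_fin]; omega
    refine ⟨fun i => decide (i ∈ Tᶜ), ?_⟩
    rw [Finset.mem_filter, pulls_decide]
    refine ⟨Finset.mem_univ _, hcT, fun i hi => ?_⟩
    have hiT : i ∈ T := by simpa using hi
    simpa using hT hiT
  · have hC : (completions b D ideal).Nonempty := by
      have hd : Disjoint (D.filter fun i => ideal i = true) Dᶜ :=
        Disjoint.mono_left (Finset.filter_subset _ _) disjoint_compl_right
      have hcard : ((D.filter fun i => ideal i = true) ∪ Dᶜ).card
          = (D.filter fun i => ideal i = true).card + (N - D.card) := by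
        rw [Finset.card_union_of_disjoint hd, Finset.card_compl, Fintype.card_fin]
      have hDN : D.card ≤ N := by simpa using Finset.card_le_univ D
      obtain ⟨T, hT1, hT2, hc⟩ := Finset.exists_subsuperset_card_eq
        (Finset.subset_union_left (s₁ := D.filter fun i => ideal i = true) (s₂ := Dᶜ))
        (n := b) (by omega) (by omega)
      refine ⟨fun i => decide (i ∈ T), ?_⟩
      simp only [completions, Finset.mem_filter, Finset.mem_univ, true_and, pulls_decide, hc]
      intro i hi
      cases hv : ideal i with
      | true => simpa using hT1 (by simp [hi, hv])
      | false =>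
        simp only [decide_eq_false_iff_not]
        intro hiT
        have := hT2 hiT
        simp [hi, hv] at this
    obtain ⟨a, ha, hmax⟩ := Finset.exists_max_image _ (matchesOutside D ideal) hC
    exact ⟨a, by simpa using ⟨ha, hmax⟩⟩

end Rectification

namespace BanditModel

variable {S : Type*} (M : BanditModel S) (N : ℕ)

/-! ### The `N`-armed problem -/

/-- The law of the next state vector: arms move independently according to `P`. -/
noncomputable def step [Fintype S] {N : ℕ} (s : StateVec S N) (a : ActionVec N) :
    PMF (StateVec S N) :=
  indepLaw fun i => M.P (s i) (a i)

/-- A randomized, history-dependent policy: the law of `A_t` given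
`(S_0, A_0), …, (S_{t-1}, A_{t-1})` (in this order) and `S_t`. -/
abbrev Policy (S : Type*) (N : ℕ) :=
  List (StateVec S N × ActionVec N) → StateVec S N → PMF (ActionVec N)

/-- The law of `([(S_0, A_0), …, (S_{t-1}, A_{t-1})], S_t)` under `π`, started from `s₀`. -/
noncomputable def historyLaw [Fintype S] {N : ℕ} (π : Policy S N) (s₀ : StateVec S N) :
    ℕ → PMF (List (StateVec S N × ActionVec N) × StateVec S N)
  | 0 => PMF.pure ([], s₀)
  | t + 1 => (historyLaw π s₀ t).bind fun p =>
      (π p.1 p.2).bind fun a => (M.step p.2 a).map fun s' => (p.1 ++ [(p.2, a)], s')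

/-- The law of `(S_t, A_t)`. -/
noncomputable def stateActionLaw [Fintype S] {N : ℕ} (π : Policy S N) (s₀ : StateVec S N) (t : ℕ) :
    PMF (StateVec S N × ActionVec N) :=
  (M.historyLaw π s₀ t).bind fun p => (π p.1 p.2).map fun a => (p.2, a)

/-- `(1/T) ∑_{t < T} (1/N) ∑_i E[r(S_t(i), A_t(i))]`. -/
noncomputable def averageReward [Fintype S] {N : ℕ} (π : Policy S N) (s₀ : StateVec S N) (T : ℕ) :
    ℝ :=
  open Classical in
  (1 / (T : ℝ)) * ∑ t ∈ Finset.range T, (1 / (N : ℝ)) * ∑ i : Fin N,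
    ∑ p : StateVec S N × ActionVec N,
      (M.stateActionLaw π s₀ t p).toReal * M.r (p.1 i) (p.2 i)

/-- The budget constraint: almost surely, exactly `αN` arms are pulled at every time. -/
def IsFeasible [Fintype S] {N : ℕ} (π : Policy S N) (s₀ : StateVec S N) : Prop :=
  ∀ t, ∀ p ∈ (M.stateActionLaw π s₀ t).support, (pulls p.2 : ℝ) = M.α * N

/-- `R*(N, s₀)`: the supremum over all feasible policies of the liminf average reward. -/
noncomputable def optimalReward [Fintype S] {N : ℕ} (s₀ : StateVec S N) : ℝ :=
  sSup {ρ : ℝ | ∃ π : Policy S N, M.IsFeasible π s₀ ∧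
    ρ = liminf (fun T : ℕ => M.averageReward π s₀ T) atTop}

/-- `r_max = max_{s,a} |r(s, a)|`. -/
noncomputable def rMax : ℝ := ⨆ p : S × Bool, |M.r p.1 p.2|

/-- `β = min(α, 1 - α)`. -/
noncomputable def β : ℝ := min M.α (1 - M.α)

/-- The number `αN` of arms to pull (meaningful when `αN` is an integer). -/
noncomputable def budget : ℕ := ⌊M.α * N⌋₊

theorem budget_le : M.budget N ≤ N := by
  refine Nat.floor_le_of_le ?_
  have := M.α_lt_one
  have hN : (0 : ℝ) ≤ N := Nat.cast_nonneg N
  nlinarith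

theorem β_nonneg : 0 ≤ M.β := le_min M.α_pos.le (sub_nonneg.2 M.α_lt_one.le)

/-! ### The linear program and the optimal single-armed policy -/

structure IsLPFeasible [Fintype S] (y : S → Bool → ℝ) : Prop where
  budget_eq : ∑ s, y s true = M.α
  balance : ∀ s, ∑ s', ∑ a, y s' a * (M.P s' a s).toReal = ∑ a, y s a
  total : ∑ s, ∑ a, y s a = 1
  nonneg : ∀ s a, 0 ≤ y s a

/-- `y` is an optimal solution of the linear program. -/
structure IsLPOptimal [Fintype S] (y : S → Bool → ℝ) : Prop where
  feasible : M.IsLPFeasible y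
  optimal : ∀ y', M.IsLPFeasible y' →
    ∑ s, ∑ a, M.r s a * y' s a ≤ ∑ s, ∑ a, M.r s a * y s a

/-- The probability `π̄(a | s)` of the single-armed policy obtained from `y`. -/
noncomputable def singleArmProb (y : S → Bool → ℝ) (s : S) (a : Bool) : ℝ :=
  open Classical in
  if 0 < y s false + y s true then y s a / (y s false + y s true) else 1 / 2

/-- The law `π̄(· | s)`. -/
noncomputable def singleArmPolicy (y : S → Bool → ℝ) (hy : ∀ s a, 0 ≤ y s a) (s : S) : PMF Bool :=
  PMF.ofFintype (fun a => ENNReal.ofReal (singleArmProb y s a)) (by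
    have h0 : ∀ a, 0 ≤ singleArmProb y s a := by
      intro a
      unfold singleArmProb
      split_ifs with h
      · exact div_nonneg (hy s a) h.le
      · norm_num
    rw [Fintype.sum_bool, ← ENNReal.ofReal_add (h0 _) (h0 _)]
    have h1 : singleArmProb y s true + singleArmProb y s false = 1 := by
      unfold singleArmProb
      split_ifs with h
      · rw [← add_div, add_comm, div_self h.ne']
      · norm_num
    rw [h1, ENNReal.ofReal_one])

/-- The transition matrix induced by the single-armed policy obtained from `y`. -/
noncomputable def singleArmMatrix (y : S → Bool → ℝ) : Matrix S S ℝ :=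
  Matrix.of fun s s' => ∑ a, singleArmProb y s a * (M.P s a s').toReal

/-! ### The set-optimization policy

Here `Q` is the transition matrix of the optimal single-armed policy, and `μ` its stationary
distribution. -/

section SetOptimization

variable [Fintype S] [DecidableEq S] {N : ℕ} (Q : Matrix S S ℝ) (μ : S → ℝ)

/-- `h_W(x, D) = ‖x(D) - m(D) μ‖_W`. -/
noncomputable def hW (s : StateVec S N) (D : Finset (Fin N)) : ℝ :=
  weightedNorm (weightMatrix Q μ) (stateCount s D - fraction D • μ)

/-- `L_W = 2 √λ_W`. -/
noncomputable def lipschitzW : ℝ := 2 * Real.sqrt (lambdaW Q μ)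

/-- The slack `δ(x, D) = β (1 - m(D)) - ½ ‖x(D) - m(D) μ‖₁`. -/
noncomputable def slack (s : StateVec S N) (D : Finset (Fin N)) : ℝ :=
  M.β * (1 - fraction D) - (1 / 2) * ∑ z, |stateCount s D z - fraction D * μ z|

/-- `D` minimizes `h_W(x, D) + L_W (1 - m(D))` subject to `δ(x, D) ≥ 0`. -/
def IsOptimalSet (s : StateVec S N) (D : Finset (Fin N)) : Prop :=
  0 ≤ M.slack μ s D ∧ ∀ D' : Finset (Fin N), 0 ≤ M.slack μ s D' →
    hW Q μ s D + lipschitzW Q μ * (1 - fraction D)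
      ≤ hW Q μ s D' + lipschitzW Q μ * (1 - fraction D')

/-- The optimal sets not strictly contained in another optimal set. -/
noncomputable def maximalOptimalSets (s : StateVec S N) : Finset (Finset (Fin N)) :=
  open Classical in
  Finset.univ.filter fun D => Maximal (M.IsOptimalSet Q μ s) D

theorem maximalOptimalSets_nonempty (s : StateVec S N) :
    (M.maximalOptimalSets Q μ s).Nonempty := by
  classical
  have hF : (Finset.univ.filter fun D : Finset (Fin N) => 0 ≤ M.slack μ s D).Nonempty :=
    ⟨∅, by simp [slack, fraction, stateCount, M.β_nonneg]⟩
  obtain ⟨D₀, h₀, hmin⟩ := Finset.exists_min_image _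
    (fun D => hW Q μ s D + lipschitzW Q μ * (1 - fraction D)) hF
  have hopt : M.IsOptimalSet Q μ s D₀ :=
    ⟨by simpa using h₀, fun D' h' => hmin D' (by simpa using h')⟩
  obtain ⟨D, -, hD⟩ := (Set.toFinite {D | M.IsOptimalSet Q μ s D}).exists_le_maximal hopt
  exact ⟨D, by simpa [maximalOptimalSets] using hD⟩

/-- The set-optimization policy: given `S_t = s`, pick the focus set `D` uniformly among the maximal
optimal sets, sample ideal actions independently from `π̄(· | s i)`, and pick the action
vector uniformly among those admitted by the rectification step. It ignores the past. -/
noncomputable def setOptPolicy (y : S → Bool → ℝ) (hy : ∀ s a, 0 ≤ y s a) (μ : S → ℝ) (N : ℕ) :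
    Policy S N := fun _ s =>
  (PMF.uniformOfFinset (M.maximalOptimalSets (M.singleArmMatrix y) μ s)
    (M.maximalOptimalSets_nonempty _ μ s)).bind fun D =>
  (indepLaw fun i => singleArmPolicy y hy (s i)).bind fun ideal =>
  PMF.uniformOfFinset (rectified (M.budget N) D ideal) (rectified_nonempty (M.budget_le N) D ideal)

end SetOptimization

/-- The law of `([f(S_0), …, f(S_{t-1})], f(S_t))`. -/
noncomputable def observedLaw [Fintype S] {N : ℕ} {E : Type*} (f : StateVec S N → E)
    (π : Policy S N) (s₀ : StateVec S N) (t : ℕ) : PMF (List E × E) :=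
  (M.historyLaw π s₀ t).map fun p => (p.1.map (fun q => f q.1), f p.2)

/-- Under `π`, the process `f(S_t)` is a time-homogeneous Markov chain, with a transition kernel
`K` that does not depend on the initial state. -/
def IsMarkovChainUnder [Fintype S] {N : ℕ} {E : Type*} (f : StateVec S N → E)
    (π : Policy S N) : Prop :=
  ∃ K : E → PMF E, ∀ s₀ t, M.observedLaw f π s₀ (t + 1) =
    (M.observedLaw f π s₀ t).bind fun p => (K p.2).map fun e => (p.1 ++ [p.2], e)

end BanditModel

/-! The optimal value of the linear program bounds `optimalReward` from above. The time-averaged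
state-action frequencies of any feasible policy stay in a compact set, and their defect in the
balance equations telescopes to `O(1/T)`. Every limit point is therefore feasible for the program,
and the liminf of the rewards is at most the reward of such a point (`liminf_averageReward_le`).

For the set-optimization policy the Lyapunov function is the value `V` of the minimization that
defines the focus set: the minimum of `h_W(D) + L_W (1 - m(D))` over sets with nonnegative slack.
Three facts make it work.

Contraction: on vectors of total mass zero, `W` turns `v ↦ v Q` into a contraction with factor `1 -
1/(2 λ_W)` (`weightedNorm_vecMul_le`), because applying `Q` drops the first term of the series for
`W`.

Conformity: nonnegative slack keeps the expected number of ideal pulls in `D` within the range that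
the budget allows. Only fluctuations of order `√N` force arms of `D` off their ideal actions
(`expect_mismatches_le`), so the new state count on `D` differs from `X(D) Q` by a noise of mean
`O(1/√N)`. If the noise makes `D` infeasible, removing a proportional share of its arms restores
feasibility (`exists_subset_slack_nonneg`). Since `h_W` is `L_W`-Lipschitz in `D`, this gives `E V'
≤ V - h_W(D) / (2 λ_W) + O(1/√N)`.

Coverage: by maximality `D` cannot be enlarged, so `1 - m(D)` is at most a multiple of `h_W(D)`, up
to `O(1/N)` (`IsErgodicPair.coverage`).

The expected reward in one step falls short of the program's value by at most a multiple of `‖X(D) -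
m(D) μ‖₁ + (1 - m(D)) + 1/√N` (`expect_reward_ge`), hence by a multiple of `h_W(D)` up to `O(1/√N)`,
hence by a multiple of `V - E V'` up to `O(1/√N)` (`reward_drift`). Averaged over time, the
differences of `V` telescope away. The average reward converges by the mean ergodic theorem.

The Markov property is a symmetry argument: the policy and the dynamics commute with relabelling the
arms, and two state vectors with the same counts differ by a relabelling. -/

open Filter Topology

set_option linter.unusedSectionVars false

/-! ### Expectations over finite types -/

section Expect

variable {A B : Type*} [Fintype A] [Fintype B]

/-- The expectation of `f` under a law `p` on a finite type. -/
noncomputable def PMF.expect (p : PMF A) (f : A → ℝ) : ℝ := ∑ x, (p x).toReal * f x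

theorem PMF.sum_toReal (p : PMF A) : ∑ x, (p x).toReal = 1 := by
  rw [← ENNReal.toReal_sum fun x _ => p.apply_ne_top x, ← tsum_fintype (L := .unconditional A), p.tsum_coe,
    ENNReal.toReal_one]

theorem PMF.expect_const (p : PMF A) (c : ℝ) : p.expect (fun _ => c) = c := by
  rw [PMF.expect, ← Finset.sum_mul, p.sum_toReal, one_mul]

theorem PMF.expect_add (p : PMF A) (f g : A → ℝ) :
    p.expect (fun x => f x + g x) = p.expect f + p.expect g := by
  simp [PMF.expect, mul_add, Finset.sum_add_distrib]

theorem PMF.expect_sub (p : PMF A) (f g : A → ℝ) :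
    p.expect (fun x => f x - g x) = p.expect f - p.expect g := by
  simp [PMF.expect, mul_sub, Finset.sum_sub_distrib]

theorem PMF.expect_const_mul (p : PMF A) (c : ℝ) (f : A → ℝ) :
    p.expect (fun x => c * f x) = c * p.expect f := by
  simp only [PMF.expect, Finset.mul_sum]
  exact Finset.sum_congr rfl fun x _ => by ring

theorem PMF.expect_sum {ι : Type*} (p : PMF A) (s : Finset ι) (f : ι → A → ℝ) :
    p.expect (fun x => ∑ i ∈ s, f i x) = ∑ i ∈ s, p.expect (f i) := by
  simp only [PMF.expect, Finset.mul_sum]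
  exact Finset.sum_comm

theorem PMF.expect_mono_support (p : PMF A) {f g : A → ℝ} (h : ∀ x ∈ p.support, f x ≤ g x) :
    p.expect f ≤ p.expect g := by
  refine Finset.sum_le_sum fun x _ => ?_
  by_cases hx : x ∈ p.support
  · exact mul_le_mul_of_nonneg_left (h x hx) ENNReal.toReal_nonneg
  · rw [PMF.mem_support_iff, not_not] at hx
    simp [hx]

theorem PMF.expect_mono (p : PMF A) {f g : A → ℝ} (h : ∀ x, f x ≤ g x) :
    p.expect f ≤ p.expect g := p.expect_mono_support fun x _ => h x

theorem PMF.expect_congr_support (p : PMF A) {f g : A → ℝ} (h : ∀ x ∈ p.support, f x = g x) :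
    p.expect f = p.expect g :=
  le_antisymm (p.expect_mono_support fun x hx => (h x hx).le)
    (p.expect_mono_support fun x hx => (h x hx).ge)

theorem PMF.expect_nonneg (p : PMF A) {f : A → ℝ} (h : ∀ x, 0 ≤ f x) : 0 ≤ p.expect f :=
  Finset.sum_nonneg fun x _ => mul_nonneg ENNReal.toReal_nonneg (h x)

theorem PMF.expect_le_of_support (p : PMF A) {f : A → ℝ} {c : ℝ}
    (h : ∀ x ∈ p.support, f x ≤ c) : p.expect f ≤ c :=
  (p.expect_mono_support h).trans_eq (p.expect_const c)

theorem PMF.abs_expect_le (p : PMF A) (f : A → ℝ) : |p.expect f| ≤ p.expect fun x => |f x| := by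
  refine (Finset.abs_sum_le_sum_abs _ _).trans_eq (Finset.sum_congr rfl fun x _ => ?_)
  rw [abs_mul, abs_of_nonneg ENNReal.toReal_nonneg]

theorem PMF.toReal_bind_apply {C : Type*} (p : PMF C) (q : C → PMF B) (b : B) :
    (p.bind q b).toReal = ∑' a, (p a).toReal * (q a b).toReal := by
  rw [PMF.bind_apply, ENNReal.tsum_toReal_eq]
  · simp [ENNReal.toReal_mul]
  · exact fun a => ENNReal.mul_ne_top (p.apply_ne_top a) ((q a).apply_ne_top b)

theorem PMF.expect_bind (p : PMF A) (q : A → PMF B) (f : B → ℝ) :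
    (p.bind q).expect f = p.expect fun a => (q a).expect f := by
  simp only [PMF.expect, PMF.toReal_bind_apply, tsum_fintype, Finset.sum_mul, Finset.mul_sum]
  rw [Finset.sum_comm]
  simp only [mul_assoc]

theorem PMF.expect_pure (a : A) (f : A → ℝ) : (PMF.pure a).expect f = f a := by
  classical
  simp only [PMF.expect, PMF.pure_apply]
  rw [Finset.sum_eq_single a] <;> simp +contextual

theorem PMF.expect_map (p : PMF A) (g : A → B) (f : B → ℝ) :
    (p.map g).expect f = p.expect fun a => f (g a) := by
  rw [← PMF.bind_pure_comp, PMF.expect_bind]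
  simp [PMF.expect_pure]

theorem PMF.expect_ite_eq [DecidableEq A] (p : PMF A) (a : A) :
    p.expect (fun x => if x = a then 1 else 0) = (p a).toReal := by
  simp [PMF.expect]

theorem PMF.sq_expect_le (p : PMF A) (f : A → ℝ) : p.expect f ^ 2 ≤ p.expect fun x => f x ^ 2 := by
  have h : 0 ≤ p.expect fun x => (f x - p.expect f) ^ 2 := p.expect_nonneg fun x => sq_nonneg _
  have h2 : (p.expect fun x => (f x - p.expect f) ^ 2)
      = p.expect (fun x => f x ^ 2) - p.expect f ^ 2 := by
    have : (fun x => (f x - p.expect f) ^ 2)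
        = fun x => (f x ^ 2 - (2 * p.expect f) * f x) + p.expect f ^ 2 := by
      funext x; ring
    rw [this, PMF.expect_add, PMF.expect_sub, PMF.expect_const_mul, PMF.expect_const]
    ring
  linarith

theorem PMF.expect_le_sqrt (p : PMF A) {f : A → ℝ} {c : ℝ} (h : p.expect (fun x => f x ^ 2) ≤ c) :
    p.expect f ≤ √c :=
  Real.le_sqrt_of_sq_le ((p.sq_expect_le f).trans h)

/-! ### Independent coordinates -/

variable {N : ℕ} (p : Fin N → PMF A)

/-- A product of sums expands into a sum over all tuples. Putting `1` in the remaining factors then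
gives the laws of single coordinates and of pairs. -/
theorem expect_indepLaw_prod (g : Fin N → A → ℝ) :
    (indepLaw p).expect (fun a => ∏ i, g i (a i)) = ∏ i, (p i).expect (g i) := by
  classical
  have h := Finset.prod_univ_sum (fun _ : Fin N => (Finset.univ : Finset A))
    (fun i a => (p i a).toReal * g i a)
  rw [Fintype.piFinset_univ] at h
  simp only [PMF.expect]
  rw [h]
  refine Finset.sum_congr rfl fun a _ => ?_
  rw [Finset.prod_mul_distrib]
  simp [indepLaw, PMF.ofFintype_apply, ENNReal.toReal_prod]

theorem expect_indepLaw_apply (i : Fin N) (g : A → ℝ) :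
    (indepLaw p).expect (fun a => g (a i)) = (p i).expect g := by
  classical
  have h := expect_indepLaw_prod p (fun j a => if j = i then g a else 1)
  simp only [Finset.prod_ite_eq', Finset.mem_univ, if_true] at h
  rw [h, Finset.prod_eq_single i]
  · simp
  · intro j _ hj
    simp [hj, PMF.expect_const]
  · simp

theorem expect_indepLaw_mul {i j : Fin N} (hij : i ≠ j) (g g' : A → ℝ) :
    (indepLaw p).expect (fun a => g (a i) * g' (a j)) = (p i).expect g * (p j).expect g' := by
  classical
  have h := expect_indepLaw_prod p
    (fun k a => (if k = i then g a else 1) * (if k = j then g' a else 1))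
  simp only [Finset.prod_mul_distrib, Finset.prod_ite_eq', Finset.mem_univ, if_true] at h
  rw [h]
  have key : ∀ k, (p k).expect (fun a => (if k = i then g a else 1) * (if k = j then g' a else 1))
      = (if k = i then (p i).expect g else 1) * (if k = j then (p j).expect g' else 1) := by
    intro k
    by_cases h1 : k = i
    · subst h1; simp [hij]
    · by_cases h2 : k = j
      · subst h2; simp [h1]
      · simp [h1, h2, PMF.expect_const]
  simp only [key, Finset.prod_mul_distrib, Finset.prod_ite_eq', Finset.mem_univ, if_true]

/-- The second moment of a sum of independent centred variables. -/
theorem expect_indepLaw_sum_sq (D : Finset (Fin N)) (g : Fin N → A → ℝ)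
    (hg : ∀ i ∈ D, (p i).expect (g i) = 0) :
    (indepLaw p).expect (fun a => (∑ i ∈ D, g i (a i)) ^ 2)
      = ∑ i ∈ D, (p i).expect fun x => g i x ^ 2 := by
  classical
  have h1 : (fun a : Fin N → A => (∑ i ∈ D, g i (a i)) ^ 2)
      = fun a => ∑ i ∈ D, ∑ j ∈ D, g i (a i) * g j (a j) := by
    funext a; rw [sq, Finset.sum_mul_sum]
  rw [h1, PMF.expect_sum]
  refine Finset.sum_congr rfl fun i hi => ?_
  rw [PMF.expect_sum, Finset.sum_eq_single i]
  · rw [← expect_indepLaw_apply p i]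
    simp [sq]
  · intro j hj hji
    rw [expect_indepLaw_mul p hji.symm, hg i hi, zero_mul]
  · exact fun h => absurd hi h

/-- The second moment of a centred sum of independent variables is at most the sum of the second
moments. -/
theorem expect_indepLaw_centred_sq_le (D : Finset (Fin N)) (g : Fin N → A → ℝ) :
    (indepLaw p).expect (fun a => (∑ i ∈ D, (g i (a i) - (p i).expect (g i))) ^ 2)
      ≤ ∑ i ∈ D, (p i).expect fun x => g i x ^ 2 := by
  rw [expect_indepLaw_sum_sq p D (fun i x => g i x - (p i).expect (g i))]
  · refine Finset.sum_le_sum fun i _ => ?_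
    have : (fun x => (g i x - (p i).expect (g i)) ^ 2)
        = fun x => (g i x ^ 2 - (2 * (p i).expect (g i)) * g i x) + (p i).expect (g i) ^ 2 := by
      funext x; ring
    rw [this, PMF.expect_add, PMF.expect_sub, PMF.expect_const_mul, PMF.expect_const]
    nlinarith [sq_nonneg ((p i).expect (g i))]
  · intro i _
    rw [PMF.expect_sub, PMF.expect_const, sub_self]

end Expect

/-! ### Convergence of aperiodic unichains -/

section Convergence

variable {S : Type*} [Fintype S]

/-- The `ℓ¹` norm of a vector. -/
def l1Norm (v : S → ℝ) : ℝ := ∑ z, |v z|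

theorem l1Norm_nonneg (v : S → ℝ) : 0 ≤ l1Norm v := Finset.sum_nonneg fun _ _ => abs_nonneg _

theorem l1Norm_add_le (v w : S → ℝ) : l1Norm (v + w) ≤ l1Norm v + l1Norm w := by
  simp only [l1Norm, ← Finset.sum_add_distrib]
  exact Finset.sum_le_sum fun z _ => abs_add_le _ _

theorem l1Norm_sub_le (v w : S → ℝ) : l1Norm (v - w) ≤ l1Norm v + l1Norm w := by
  simp only [l1Norm, ← Finset.sum_add_distrib]
  exact Finset.sum_le_sum fun z _ => abs_sub _ _

theorem l1Norm_smul (c : ℝ) (v : S → ℝ) : l1Norm (c • v) = |c| * l1Norm v := by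
  simp [l1Norm, abs_mul, Finset.mul_sum]

theorem abs_le_l1Norm (v : S → ℝ) (z : S) : |v z| ≤ l1Norm v :=
  Finset.single_le_sum (f := fun z => |v z|) (fun _ _ => abs_nonneg _) (Finset.mem_univ z)

theorem l1Norm_vecMul_le_of_nonneg {Q : Matrix S S ℝ} (h0 : ∀ i j, 0 ≤ Q i j) {c : ℝ}
    (h1 : ∀ i, ∑ j, Q i j = c) (v : S → ℝ) : l1Norm (Matrix.vecMul v Q) ≤ c * l1Norm v := by
  have h : ∀ z, |Matrix.vecMul v Q z| ≤ ∑ i, |v i| * Q i z := fun z => by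
    refine (Finset.abs_sum_le_sum_abs _ _).trans_eq (Finset.sum_congr rfl fun i _ => ?_)
    rw [abs_mul, abs_of_nonneg (h0 i z)]
  refine (Finset.sum_le_sum fun z _ => h z).trans_eq ?_
  rw [Finset.sum_comm]
  simp only [← Finset.mul_sum, h1, l1Norm]
  rw [Finset.mul_sum]
  exact Finset.sum_congr rfl fun i _ => mul_comm _ _

variable [DecidableEq S]

theorem mem_rowStochastic_sum {Q : Matrix S S ℝ} :
    Q ∈ Matrix.rowStochastic ℝ S ↔ (∀ i j, 0 ≤ Q i j) ∧ ∀ i, ∑ j, Q i j = 1 :=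
  Matrix.mem_rowStochastic_iff_sum

theorem l1Norm_vecMul_le {Q : Matrix S S ℝ} (hQ : Q ∈ Matrix.rowStochastic ℝ S) (v : S → ℝ) :
    l1Norm (Matrix.vecMul v Q) ≤ l1Norm v := by
  rw [mem_rowStochastic_sum] at hQ
  simpa using l1Norm_vecMul_le_of_nonneg hQ.1 hQ.2 v

theorem sum_vecMul {Q : Matrix S S ℝ} (hQ : Q ∈ Matrix.rowStochastic ℝ S) (v : S → ℝ) :
    ∑ z, Matrix.vecMul v Q z = ∑ z, v z := by
  rw [mem_rowStochastic_sum] at hQ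
  simp only [Matrix.vecMul, dotProduct]
  rw [Finset.sum_comm]
  simp [← Finset.mul_sum, hQ.2]

/-- Doeblin's contraction. -/
theorem l1Norm_vecMul_le_of_minorized {Q : Matrix S S ℝ} (hQ : Q ∈ Matrix.rowStochastic ℝ S) {i : S} {c : ℝ}
    (hc : ∀ j, c ≤ Q j i) {v : S → ℝ} (hv : ∑ z, v z = 0) :
    l1Norm (Matrix.vecMul v Q) ≤ (1 - c) * l1Norm v := by
  rw [mem_rowStochastic_sum] at hQ
  let Q' : Matrix S S ℝ := fun j z => Q j z - if z = i then c else 0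
  have h : Matrix.vecMul v Q = Matrix.vecMul v Q' := by
    funext z
    simp only [Matrix.vecMul, dotProduct, Q', mul_sub, Finset.sum_sub_distrib, ← Finset.sum_mul, hv]
    ring
  rw [h]
  refine l1Norm_vecMul_le_of_nonneg (fun j z => ?_) (fun j => ?_) v
  · simp only [Q']
    split_ifs with hz
    · subst hz; linarith [hc j]
    · linarith [hQ.1 j z]
  · simp [Q', Finset.sum_sub_distrib, hQ.2]

theorem pow_apply_pos_of_mul {Q : Matrix S S ℝ} (hQ : Q ∈ Matrix.rowStochastic ℝ S) {a b : ℕ}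
    {i j k : S} (h1 : 0 < (Q ^ a) i j) (h2 : 0 < (Q ^ b) j k) : 0 < (Q ^ (a + b)) i k := by
  rw [pow_add, Matrix.mul_apply]
  have hn : ∀ n i j, 0 ≤ (Q ^ n) i j := fun n => (mem_rowStochastic_sum.1 (pow_mem hQ n)).1
  exact Finset.sum_pos' (fun l _ => mul_nonneg (hn _ _ _) (hn _ _ _))
    ⟨j, Finset.mem_univ _, mul_pos h1 h2⟩

theorem Accessible.trans {Q : Matrix S S ℝ} (hQ : Q ∈ Matrix.rowStochastic ℝ S) {i j k : S}
    (h1 : Accessible Q i j) (h2 : Accessible Q j k) : Accessible Q i k := by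
  obtain ⟨a, ha⟩ := h1
  obtain ⟨b, hb⟩ := h2
  exact ⟨a + b, pow_apply_pos_of_mul hQ ha hb⟩

theorem Accessible.refl (Q : Matrix S S ℝ) (i : S) : Accessible Q i i := ⟨0, by simp⟩

/-- Among the states accessible from `i`, one with the fewest accessible states is recurrent: a
state reached from it sees no more, hence exactly as much, and so can return. -/
theorem exists_accessible_recurrent {Q : Matrix S S ℝ} (hQ : Q ∈ Matrix.rowStochastic ℝ S) (i : S) :
    ∃ j, Accessible Q i j ∧ IsRecurrentState Q j := by
  classical
  let F : S → ℕ := fun j => (Finset.univ.filter fun k => Accessible Q j k).card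
  obtain ⟨j, hj, hmin⟩ := Finset.exists_min_image (Finset.univ.filter fun k => Accessible Q i k) F
    ⟨i, by simpa using Accessible.refl Q i⟩
  simp only [Finset.mem_filter, Finset.mem_univ, true_and] at hj hmin
  refine ⟨j, hj, fun k hk => ?_⟩
  have hsub : (Finset.univ.filter fun l => Accessible Q k l)
      ⊆ Finset.univ.filter fun l => Accessible Q j l := by
    intro l hl
    simp only [Finset.mem_filter, Finset.mem_univ, true_and] at hl ⊢
    exact hk.trans hQ hl
  have heq := Finset.eq_of_subset_of_card_le hsub (hmin k (hj.trans hQ hk))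
  have : j ∈ Finset.univ.filter fun l => Accessible Q k l := by
    rw [heq]; simpa using Accessible.refl Q j
  simpa using this

/-- The return times to a recurrent state `i` form an additive semigroup with gcd `1`, so all large
times are return times. Every state reaches `i`, and slack in time can be spent on returns, so a
common time `m` serves all starting states. This is the hypothesis of Doeblin's contraction. -/
theorem IsAperiodicUnichain.exists_minorized {Q : Matrix S S ℝ} (hQ : Q ∈ Matrix.rowStochastic ℝ S)
    (h : IsAperiodicUnichain Q) : ∃ (m : ℕ) (i : S) (c : ℝ), 0 < m ∧ 0 < c ∧
      ∀ j, c ≤ (Q ^ m) j i := by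
  obtain ⟨⟨⟨i, hi⟩, huni⟩, hap⟩ := h
  have hacc : ∀ j, ∃ n, 0 < (Q ^ n) j i := fun j => by
    obtain ⟨k, hk, hkr⟩ := exists_accessible_recurrent hQ j
    exact hk.trans hQ (huni k i hkr hi)
  let R : Set ℕ := {n | 0 < n ∧ 0 < (Q ^ n) i i}
  have hgcd : Nat.setGcd R = 1 :=
    hap i hi _ fun n hn hpos => Nat.setGcd_dvd_of_mem (s := R) ⟨hn, hpos⟩
  obtain ⟨n₀, hn₀⟩ := Nat.exists_mem_closure_of_ge R
  have hret : ∀ n ≥ n₀, 0 < (Q ^ n) i i := by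
    intro n hn
    have hmem := hn₀ n hn (by rw [hgcd]; exact one_dvd _)
    refine AddSubmonoid.closure_induction (motive := fun n _ => 0 < (Q ^ n) i i) ?_ ?_ ?_ hmem
    · exact fun x hx => hx.2
    · simp
    · exact fun x y _ _ hx hy => pow_apply_pos_of_mul hQ hx hy
  choose n hn using hacc
  let m := n₀ + ∑ j, n j + 1
  have hpos : ∀ j, 0 < (Q ^ m) j i := by
    intro j
    have hle : n j ≤ ∑ j, n j := Finset.single_le_sum (fun _ _ => Nat.zero_le _) (Finset.mem_univ j)
    have : m = n j + (m - n j) := by omega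
    rw [this]
    exact pow_apply_pos_of_mul hQ (hn j) (hret _ (by omega))
  obtain ⟨j₀, -, hj₀⟩ := Finset.exists_min_image Finset.univ (fun j => (Q ^ m) j i) ⟨i, Finset.mem_univ i⟩
  exact ⟨m, i, _, Nat.succ_pos _, hpos j₀, fun j => hj₀ j (Finset.mem_univ j)⟩

theorem sum_vecMul_sub_rowConst {Q : Matrix S S ℝ} (hQ : Q ∈ Matrix.rowStochastic ℝ S) {μ : S → ℝ}
    (hμ : ∑ s, μ s = 1) (v : S → ℝ) : ∑ z, Matrix.vecMul v (Q - rowConst μ) z = 0 := by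
  rw [Matrix.vecMul_sub]
  simp only [Pi.sub_apply, Finset.sum_sub_distrib, sum_vecMul hQ]
  simp only [Matrix.vecMul, dotProduct, rowConst, Matrix.of_apply, ← Finset.sum_mul]
  simp [← Finset.mul_sum, hμ]

theorem vecMul_sub_rowConst {Q : Matrix S S ℝ} {μ v : S → ℝ} (hv : ∑ z, v z = 0) :
    Matrix.vecMul v (Q - rowConst μ) = Matrix.vecMul v Q := by
  rw [Matrix.vecMul_sub, sub_eq_self]
  funext z
  simp [Matrix.vecMul, dotProduct, rowConst, ← Finset.sum_mul, hv]

theorem vecMul_sub_rowConst_pow {Q : Matrix S S ℝ} (hQ : Q ∈ Matrix.rowStochastic ℝ S) {μ v : S → ℝ}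
    (hv : ∑ z, v z = 0) (k : ℕ) :
    Matrix.vecMul v ((Q - rowConst μ) ^ k) = Matrix.vecMul v (Q ^ k) := by
  induction k with
  | zero => simp
  | succ k ih =>
    rw [pow_succ, ← Matrix.vecMul_vecMul, ih, vecMul_sub_rowConst, Matrix.vecMul_vecMul, ← pow_succ]
    rw [sum_vecMul (pow_mem hQ k), hv]

/-- A partial sum `A` satisfies `A ≤ (first m terms) + q A`, which bounds it. -/
theorem summable_of_shift_le {a : ℕ → ℝ} (h0 : ∀ k, 0 ≤ a k) {m : ℕ} {q : ℝ} (hq : q < 1)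
    (h : ∀ k, a (k + m) ≤ q * a k) : Summable a := by
  by_cases hq0 : q < 0
  · have : ∀ k, a k = 0 := fun k => by nlinarith [h k, h0 k, h0 (k + m)]
    rw [show a = fun _ => 0 from funext this]
    exact summable_zero
  refine summable_of_sum_range_le (c := (∑ k ∈ Finset.range m, a k) / (1 - q)) h0 fun n => ?_
  rw [le_div_iff₀ (by linarith)]
  have h1 : ∑ k ∈ Finset.range n, a k ≤ ∑ k ∈ Finset.range (m + n), a k :=
    Finset.sum_le_sum_of_subset_of_nonneg (Finset.range_mono (by omega)) fun k _ _ => h0 k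
  rw [Finset.sum_range_add] at h1
  have h2 : ∑ k ∈ Finset.range n, a (m + k) ≤ q * ∑ k ∈ Finset.range n, a k := by
    rw [Finset.mul_sum]
    exact Finset.sum_le_sum fun k _ => by rw [add_comm]; exact h k
  linarith

theorem summable_l1Norm_vecMul_pow {Q : Matrix S S ℝ} (hQ : Q ∈ Matrix.rowStochastic ℝ S)
    (h : IsAperiodicUnichain Q) {μ : S → ℝ} (hμ : ∑ s, μ s = 1) (v : S → ℝ) :
    Summable fun k => l1Norm (Matrix.vecMul v ((Q - rowConst μ) ^ k)) := by
  obtain ⟨m, i, c, hm, hc, hmin⟩ := h.exists_minorized hQ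
  -- The vector `v` need not have total mass zero, but `v (Q - Ξ)` does; the contraction is
  -- available from the first power on.
  rw [← summable_nat_add_iff 1]
  refine summable_of_shift_le (m := m) (q := 1 - c) (fun k => l1Norm_nonneg _) (by linarith) fun k => ?_
  have h0 : ∑ z, Matrix.vecMul v ((Q - rowConst μ) ^ (k + 1)) z = 0 := by
    rw [pow_succ, ← Matrix.vecMul_vecMul]
    exact sum_vecMul_sub_rowConst hQ hμ _
  have h1 : Matrix.vecMul v ((Q - rowConst μ) ^ (k + m + 1))
      = Matrix.vecMul (Matrix.vecMul v ((Q - rowConst μ) ^ (k + 1))) (Q ^ m) := by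
    rw [← vecMul_sub_rowConst_pow hQ h0 m, Matrix.vecMul_vecMul, ← pow_add]
    congr 2; omega
  rw [h1]
  exact l1Norm_vecMul_le_of_minorized (pow_mem hQ m) hmin h0

/-- The difference of two stationary distributions has mass zero and is fixed by a power of `Q` that
contracts such vectors. -/
theorem IsStationaryDist.unique {Q : Matrix S S ℝ} (hQ : Q ∈ Matrix.rowStochastic ℝ S)
    (h : IsAperiodicUnichain Q) {μ ν : S → ℝ} (hμ : IsStationaryDist Q μ)
    (hν : IsStationaryDist Q ν) : μ = ν := by
  obtain ⟨m, i, c, hm, hc, hmin⟩ := h.exists_minorized hQ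
  have hpow : ∀ {μ : S → ℝ}, IsStationaryDist Q μ → ∀ k, Matrix.vecMul μ (Q ^ k) = μ := by
    intro μ hμ k
    induction k with
    | zero => simp
    | succ k ih => rw [pow_succ, ← Matrix.vecMul_vecMul, ih, hμ.2.2]
  have h0 : ∑ z, (μ - ν) z = 0 := by simp [hμ.2.1, hν.2.1]
  have h1 := l1Norm_vecMul_le_of_minorized (pow_mem hQ m) hmin h0
  rw [Matrix.sub_vecMul, hpow hμ, hpow hν] at h1
  have h2 : l1Norm (μ - ν) = 0 := by nlinarith [l1Norm_nonneg (μ - ν)]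
  funext z
  have := abs_le_l1Norm (μ - ν) z
  rw [h2] at this
  simpa [sub_eq_zero] using abs_nonpos_iff.1 this

end Convergence

/-! ### The weighted norm -/

section WeightedNorm

variable {S : Type*} [Fintype S]

/-- Cauchy–Schwarz for a semidefinite form: the quadratic polynomial `t ↦ (v + t w) W (v + t w)ᵀ` is
nonnegative, so its discriminant is not positive. -/
theorem dotProduct_mulVec_le_weightedNorm_mul {W : Matrix S S ℝ} (hW : W.PosSemidef) (v w : S → ℝ) :
    v ⬝ᵥ W.mulVec w ≤ weightedNorm W v * weightedNorm W w := by
  classical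
  have hq : ∀ u : S → ℝ, 0 ≤ u ⬝ᵥ W.mulVec u := fun u => by
    simpa using hW.dotProduct_mulVec_nonneg u
  have hsymm : w ⬝ᵥ W.mulVec v = v ⬝ᵥ W.mulVec w := by
    have h := hW.isHermitian
    rw [Matrix.dotProduct_mulVec, ← Matrix.mulVec_transpose, dotProduct_comm]
    rw [Matrix.IsHermitian, Matrix.conjTranspose_eq_transpose_of_trivial] at h
    rw [h]
  have h := discrim_le_zero (a := w ⬝ᵥ W.mulVec w) (b := 2 * (v ⬝ᵥ W.mulVec w))
    (c := v ⬝ᵥ W.mulVec v) (fun t => by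
      have := hq (v + t • w)
      simp only [Matrix.mulVec_add, Matrix.mulVec_smul, dotProduct_add, add_dotProduct,
        smul_dotProduct, dotProduct_smul, smul_eq_mul, hsymm] at this
      linarith)
  rw [discrim] at h
  rw [weightedNorm, weightedNorm, ← Real.sqrt_mul (hq v)]
  exact Real.le_sqrt_of_sq_le (by linarith)

theorem weightedNorm_add_le {W : Matrix S S ℝ} (hW : W.PosSemidef) (v w : S → ℝ) :
    weightedNorm W (v + w) ≤ weightedNorm W v + weightedNorm W w := by
  have hq : ∀ u : S → ℝ, 0 ≤ u ⬝ᵥ W.mulVec u := fun u => by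
    simpa using hW.dotProduct_mulVec_nonneg u
  have h0 : 0 ≤ weightedNorm W v + weightedNorm W w :=
    add_nonneg (Real.sqrt_nonneg _) (Real.sqrt_nonneg _)
  refine Real.sqrt_le_iff.2 ⟨h0, ?_⟩
  have h1 := dotProduct_mulVec_le_weightedNorm_mul hW v w
  have h2 := dotProduct_mulVec_le_weightedNorm_mul hW w v
  have h3 : weightedNorm W v ^ 2 = v ⬝ᵥ W.mulVec v := Real.sq_sqrt (hq v)
  have h4 : weightedNorm W w ^ 2 = w ⬝ᵥ W.mulVec w := Real.sq_sqrt (hq w)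
  simp only [Matrix.mulVec_add, dotProduct_add, add_dotProduct]
  nlinarith

variable [DecidableEq S]

/-- If `e` is an eigenvalue of `c I - W`, then `c - e` is one of `W`, so `e ≥ 0` and `c I - W` is
positive semidefinite. -/
theorem dotProduct_mulVec_le_of_eigenvalues {W : Matrix S S ℝ} (hW : W.IsHermitian) {c : ℝ}
    (hc : ∀ e, Module.End.HasEigenvalue (Matrix.toLin' W) e → e ≤ c) (v : S → ℝ) :
    v ⬝ᵥ W.mulVec v ≤ c * ∑ z, v z ^ 2 := by
  have hH : (c • (1 : Matrix S S ℝ) - W).IsHermitian :=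
    (Matrix.isHermitian_one.smul (IsSelfAdjoint.all c)).sub hW
  have hpos : (c • (1 : Matrix S S ℝ) - W).PosSemidef := by
    rw [hH.posSemidef_iff_eigenvalues_nonneg]
    intro i
    have h1 := hH.mulVec_eigenvectorBasis i
    have h0 : (WithLp.ofLp (hH.eigenvectorBasis i)) ≠ 0 := by
      intro h
      exact hH.eigenvectorBasis.orthonormal.ne_zero i (by ext j; exact congrFun h j)
    have h2 := hc (c - hH.eigenvalues i) (Module.End.hasEigenvalue_of_hasEigenvector
      (x := (WithLp.ofLp (hH.eigenvectorBasis i))) ⟨by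
        rw [Module.End.mem_eigenspace_iff, Matrix.toLin'_apply, sub_smul, ← h1, Matrix.sub_mulVec,
          Matrix.smul_mulVec, Matrix.one_mulVec, sub_sub_cancel], h0⟩)
    simp only [Pi.zero_apply]
    linarith
  have h := hpos.dotProduct_mulVec_nonneg v
  simp only [star_trivial, Matrix.sub_mulVec, Matrix.smul_mulVec, Matrix.one_mulVec,
    dotProduct_sub, dotProduct_smul, smul_eq_mul] at h
  simp only [sq]
  rw [dotProduct, dotProduct] at *
  linarith

/-- Each term of the series is `A Aᵀ` with `A = (Q - Ξ)ᵏ`, and `v A Aᵀ vᵀ` is the squared Euclidean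
norm of `v A`. All properties of `W` used below are read off this series. -/
theorem hasSum_dotProduct_weightMatrix {Q : Matrix S S ℝ} (hQ : Q ∈ Matrix.rowStochastic ℝ S)
    (h : IsAperiodicUnichain Q) {μ : S → ℝ} (hμ : ∑ s, μ s = 1) (v : S → ℝ) :
    HasSum (fun k => ∑ z, Matrix.vecMul v ((Q - rowConst μ) ^ k) z ^ 2)
      (v ⬝ᵥ (weightMatrix Q μ).mulVec v) := by
  have hs : Summable fun k : ℕ =>
      (Q - rowConst μ) ^ k * (Q.transpose - (rowConst μ).transpose) ^ k := by
    refine Pi.summable.2 fun i => Pi.summable.2 fun j => ?_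
    simp only [← Matrix.transpose_sub, ← Matrix.transpose_pow, Matrix.mul_apply,
      Matrix.transpose_apply]
    -- An entry of a term is a sum of products of entries of two rows of `(Q - Ξ)ᵏ`. One row is
    -- summable in `k`; the other is eventually bounded by `1`.
    refine summable_sum fun l _ => ?_
    have hi := summable_l1Norm_vecMul_pow hQ h hμ (Pi.single i 1)
    have hj := summable_l1Norm_vecMul_pow hQ h hμ (Pi.single j 1)
    simp only [Matrix.single_one_vecMul] at hi hj
    have hj' := hj.tendsto_atTop_zero
    have hbd := hj'.eventually (ge_mem_nhds zero_lt_one)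
    refine Summable.of_norm_bounded_eventually_nat hi ?_
    filter_upwards [hbd] with k hk
    rw [norm_mul]
    have h1 := abs_le_l1Norm (((Q - rowConst μ) ^ k).row i) l
    have h2 := (abs_le_l1Norm (((Q - rowConst μ) ^ k).row j) l).trans hk
    exact (mul_le_of_le_one_right (norm_nonneg _) h2).trans h1
  have h1 := hs.hasSum
  let φ : Matrix S S ℝ →+ ℝ :=
    { toFun := fun W => v ⬝ᵥ W.mulVec v
      map_zero' := by simp
      map_add' := fun A B => by simp [Matrix.add_mulVec] }
  have hφ : Continuous φ := by
    change Continuous fun W : Matrix S S ℝ => v ⬝ᵥ W.mulVec v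
    fun_prop
  have h2 := h1.map φ hφ
  have h3 : (fun k => ∑ z, Matrix.vecMul v ((Q - rowConst μ) ^ k) z ^ 2) = φ ∘ fun k : ℕ =>
      (Q - rowConst μ) ^ k * (Q.transpose - (rowConst μ).transpose) ^ k := by
    funext k
    change _ = v ⬝ᵥ Matrix.mulVec ((Q - rowConst μ) ^ k *
      (Q.transpose - (rowConst μ).transpose) ^ k) v
    rw [← Matrix.transpose_sub, ← Matrix.transpose_pow, Matrix.dotProduct_mulVec,
      ← Matrix.vecMul_vecMul, ← Matrix.dotProduct_mulVec, Matrix.mulVec_transpose, dotProduct]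
    simp only [sq]
  rw [h3]
  exact h2

variable {Q : Matrix S S ℝ} {μ : S → ℝ}

theorem weightMatrix_isHermitian (Q : Matrix S S ℝ) (μ : S → ℝ) :
    (weightMatrix Q μ).IsHermitian := by
  rw [Matrix.IsHermitian, Matrix.conjTranspose_eq_transpose_of_trivial, weightMatrix,
    Matrix.transpose_tsum]
  simp only [Matrix.transpose_mul, Matrix.transpose_pow, Matrix.transpose_sub,
    Matrix.transpose_transpose]

theorem weightMatrix_posSemidef (hQ : Q ∈ Matrix.rowStochastic ℝ S)
    (h : IsAperiodicUnichain Q) (hμ : ∑ s, μ s = 1) : (weightMatrix Q μ).PosSemidef := by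
  refine .of_dotProduct_mulVec_nonneg (weightMatrix_isHermitian Q μ) fun v => ?_
  rw [star_trivial]
  exact (hasSum_dotProduct_weightMatrix hQ h hμ v).nonneg fun k =>
    Finset.sum_nonneg fun z _ => sq_nonneg _

theorem sum_sq_le_dotProduct_weightMatrix (hQ : Q ∈ Matrix.rowStochastic ℝ S)
    (h : IsAperiodicUnichain Q) (hμ : ∑ s, μ s = 1) (v : S → ℝ) :
    ∑ z, v z ^ 2 ≤ v ⬝ᵥ (weightMatrix Q μ).mulVec v := by
  have := le_hasSum (hasSum_dotProduct_weightMatrix hQ h hμ v) 0 fun k _ =>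
    Finset.sum_nonneg fun z _ => sq_nonneg _
  simpa using this

/-- Replacing `v` by `v Q = v (Q - Ξ)` shifts the series by one index, and the missing term `k = 0`
is the squared Euclidean norm of `v`. -/
theorem dotProduct_weightMatrix_vecMul (hQ : Q ∈ Matrix.rowStochastic ℝ S)
    (h : IsAperiodicUnichain Q) (hμ : ∑ s, μ s = 1) {v : S → ℝ} (hv : ∑ z, v z = 0) :
    Matrix.vecMul v Q ⬝ᵥ (weightMatrix Q μ).mulVec (Matrix.vecMul v Q)
      = v ⬝ᵥ (weightMatrix Q μ).mulVec v - ∑ z, v z ^ 2 := by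
  have h1 := (hasSum_nat_add_iff' 1).2 (hasSum_dotProduct_weightMatrix hQ h hμ v)
  have h2 := hasSum_dotProduct_weightMatrix hQ h hμ (Matrix.vecMul v (Q - rowConst μ))
  simp only [Matrix.vecMul_vecMul, ← pow_succ'] at h2
  have h3 := h2.unique h1
  simpa [vecMul_sub_rowConst hv] using h3

theorem dotProduct_weightMatrix_le (Q : Matrix S S ℝ) (μ : S → ℝ) (v : S → ℝ) :
    v ⬝ᵥ (weightMatrix Q μ).mulVec v ≤ lambdaW Q μ * ∑ z, v z ^ 2 :=
  dotProduct_mulVec_le_of_eigenvalues (weightMatrix_isHermitian Q μ)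
    (fun _ he => le_csSup (Module.End.finite_hasEigenvalue _).bddAbove he) v

theorem one_le_lambdaW [Nonempty S] (hQ : Q ∈ Matrix.rowStochastic ℝ S)
    (h : IsAperiodicUnichain Q) (hμ : ∑ s, μ s = 1) : 1 ≤ lambdaW Q μ := by
  obtain ⟨i⟩ := ‹Nonempty S›
  have h1 := sum_sq_le_dotProduct_weightMatrix hQ h hμ (Pi.single i 1)
  have h2 := dotProduct_weightMatrix_le Q μ (Pi.single i 1)
  have h3 : ∑ z, (Pi.single i 1 : S → ℝ) z ^ 2 = 1 := by
    rw [Finset.sum_eq_single i] <;> simp +contextual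
  rw [h3] at h1 h2
  linarith

theorem l1Norm_le_sqrt_card_mul_sqrt (v : S → ℝ) :
    l1Norm v ≤ √(Fintype.card S) * √(∑ z, v z ^ 2) := by
  rw [← Real.sqrt_mul (Nat.cast_nonneg _)]
  refine Real.le_sqrt_of_sq_le ?_
  have := sq_sum_le_card_mul_sum_sq (s := (Finset.univ : Finset S)) (f := fun z => |v z|)
  simpa [l1Norm] using this

theorem l1Norm_le_weightedNorm (hQ : Q ∈ Matrix.rowStochastic ℝ S)
    (h : IsAperiodicUnichain Q) (hμ : ∑ s, μ s = 1) (v : S → ℝ) :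
    l1Norm v ≤ √(Fintype.card S) * weightedNorm (weightMatrix Q μ) v :=
  (l1Norm_le_sqrt_card_mul_sqrt v).trans (mul_le_mul_of_nonneg_left
    (Real.sqrt_le_sqrt (sum_sq_le_dotProduct_weightMatrix hQ h hμ v)) (Real.sqrt_nonneg _))

theorem weightedNorm_le_sqrt (hl : 0 ≤ lambdaW Q μ) (v : S → ℝ) :
    weightedNorm (weightMatrix Q μ) v ≤ √(lambdaW Q μ) * √(∑ z, v z ^ 2) := by
  rw [← Real.sqrt_mul hl]
  exact Real.sqrt_le_sqrt (dotProduct_weightMatrix_le Q μ v)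

theorem sqrt_sum_sq_le_l1Norm (v : S → ℝ) : √(∑ z, v z ^ 2) ≤ l1Norm v := by
  refine Real.sqrt_le_iff.2 ⟨l1Norm_nonneg v, ?_⟩
  have := Finset.sum_sq_le_sq_sum_of_nonneg (s := (Finset.univ : Finset S)) (f := fun z => |v z|)
    (fun _ _ => abs_nonneg _)
  simpa [l1Norm] using this

theorem weightedNorm_le_l1Norm (hl : 0 ≤ lambdaW Q μ) (v : S → ℝ) :
    weightedNorm (weightMatrix Q μ) v ≤ √(lambdaW Q μ) * l1Norm v :=
  (weightedNorm_le_sqrt hl v).trans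
    (mul_le_mul_of_nonneg_left (sqrt_sum_sq_le_l1Norm v) (Real.sqrt_nonneg _))

/-- The squared Euclidean norm lost in one step is at least `1 / λ_W` times the squared weighted
norm, and `1 - 1/λ_W ≤ (1 - 1/(2 λ_W))²`. -/
theorem weightedNorm_vecMul_le [Nonempty S] (hQ : Q ∈ Matrix.rowStochastic ℝ S)
    (h : IsAperiodicUnichain Q) (hμ : ∑ s, μ s = 1) {v : S → ℝ} (hv : ∑ z, v z = 0) :
    weightedNorm (weightMatrix Q μ) (Matrix.vecMul v Q)
      ≤ (1 - 1 / (2 * lambdaW Q μ)) * weightedNorm (weightMatrix Q μ) v := by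
  have hl := one_le_lambdaW hQ h hμ
  have h1 := dotProduct_weightMatrix_vecMul hQ h hμ hv
  have h2 := dotProduct_weightMatrix_le Q μ v
  have h0 : 0 ≤ v ⬝ᵥ (weightMatrix Q μ).mulVec v := by
    simpa using (weightMatrix_posSemidef hQ h hμ).dotProduct_mulVec_nonneg v
  have hc : 1 / (2 * lambdaW Q μ) ≤ 1 / 2 := by
    apply one_div_le_one_div_of_le <;> linarith
  refine Real.sqrt_le_iff.2 ⟨mul_nonneg (by linarith) (Real.sqrt_nonneg _), ?_⟩
  rw [mul_pow, weightedNorm, Real.sq_sqrt h0, h1]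
  have h3 : v ⬝ᵥ (weightMatrix Q μ).mulVec v / lambdaW Q μ ≤ ∑ z, v z ^ 2 := by
    rw [div_le_iff₀ (by linarith)]; linarith
  have h4 : (1 - 1 / (2 * lambdaW Q μ)) ^ 2 * (v ⬝ᵥ (weightMatrix Q μ).mulVec v)
      = v ⬝ᵥ (weightMatrix Q μ).mulVec v - v ⬝ᵥ (weightMatrix Q μ).mulVec v / lambdaW Q μ
        + (1 / (2 * lambdaW Q μ)) ^ 2 * (v ⬝ᵥ (weightMatrix Q μ).mulVec v) := by
    field_simp
    ring
  rw [h4]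
  nlinarith [mul_nonneg (sq_nonneg (1 / (2 * lambdaW Q μ))) h0]

end WeightedNorm

/-! ### The linear-programming upper bound -/

namespace BanditModel

variable {S : Type*} [Fintype S] (M : BanditModel S) {N : ℕ}

theorem map_fst_stateActionLaw (π : Policy S N) (s₀ : StateVec S N) (t : ℕ) :
    (M.stateActionLaw π s₀ t).map Prod.fst = (M.historyLaw π s₀ t).map Prod.snd := by
  simp only [stateActionLaw, PMF.map_bind, PMF.map_comp]
  rw [← PMF.bind_pure_comp]
  congr 1
  funext p
  change PMF.map (fun _ => p.2) _ = _
  exact PMF.map_const _ _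

theorem map_snd_historyLaw_succ (π : Policy S N) (s₀ : StateVec S N) (t : ℕ) :
    (M.historyLaw π s₀ (t + 1)).map Prod.snd
      = (M.stateActionLaw π s₀ t).bind fun p => M.step p.1 p.2 := by
  simp only [historyLaw, stateActionLaw, PMF.map_bind, PMF.map_comp, PMF.bind_bind, PMF.bind_map]
  congr 1
  funext p
  congr 1
  funext a
  exact PMF.map_id _

theorem abs_r_le_rMax (s : S) (a : Bool) : |M.r s a| ≤ M.rMax :=
  le_ciSup (f := fun p : S × Bool => |M.r p.1 p.2|) (Set.finite_range _).bddAbove (s, a)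

theorem averageReward_eq (π : Policy S N) (s₀ : StateVec S N) (T : ℕ) :
    M.averageReward π s₀ T = (1 / (T : ℝ)) * ∑ t ∈ Finset.range T,
      (M.stateActionLaw π s₀ t).expect fun p => (1 / (N : ℝ)) * ∑ i, M.r (p.1 i) (p.2 i) := by
  simp only [PMF.expect_const_mul, PMF.expect_sum]
  rfl

variable [DecidableEq S]

/-- The expected fraction of arms in state `s` taking action `a` at time `t`. -/
noncomputable def occupancy (π : Policy S N) (s₀ : StateVec S N) (t : ℕ) (s : S) (a : Bool) : ℝ :=
  (M.stateActionLaw π s₀ t).expect fun p =>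
    (1 / (N : ℝ)) * ∑ i, if p.1 i = s ∧ p.2 i = a then 1 else 0

/-- The time average of the occupancies. -/
noncomputable def averageOccupancy (π : Policy S N) (s₀ : StateVec S N) (T : ℕ) (s : S) (a : Bool) :
    ℝ :=
  (1 / (T : ℝ)) * ∑ t ∈ Finset.range T, M.occupancy π s₀ t s a

variable (π : Policy S N) (s₀ : StateVec S N)

theorem occupancy_nonneg (t : ℕ) (s : S) (a : Bool) : 0 ≤ M.occupancy π s₀ t s a :=
  PMF.expect_nonneg _ fun p => mul_nonneg (by positivity)
    (Finset.sum_nonneg fun i _ => by split_ifs <;> norm_num)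

theorem sum_mul_occupancy (f : S → Bool → ℝ) (t : ℕ) :
    ∑ s, ∑ a, f s a * M.occupancy π s₀ t s a = (M.stateActionLaw π s₀ t).expect fun p =>
      (1 / (N : ℝ)) * ∑ i, f (p.1 i) (p.2 i) := by
  simp only [occupancy, ← PMF.expect_const_mul, ← PMF.expect_sum]
  congr 1
  funext p
  simp only [Finset.mul_sum]
  rw [Finset.sum_congr rfl fun s _ => Finset.sum_comm, Finset.sum_comm]
  refine Finset.sum_congr rfl fun i _ => ?_
  rw [Finset.sum_eq_single (p.1 i), Finset.sum_eq_single (p.2 i)]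
  · simp; ring
  · intro a _ ha
    simp [ha.symm]
  · simp
  · intro s _ hs
    simp [hs.symm]
  · simp

theorem sum_mul_averageOccupancy (f : S → Bool → ℝ) (T : ℕ) :
    ∑ s, ∑ a, f s a * M.averageOccupancy π s₀ T s a
      = (1 / (T : ℝ)) * ∑ t ∈ Finset.range T, ∑ s, ∑ a, f s a * M.occupancy π s₀ t s a := by
  simp only [averageOccupancy, Finset.mul_sum]
  rw [Finset.sum_congr rfl fun s _ => Finset.sum_comm, Finset.sum_comm]
  refine Finset.sum_congr rfl fun t _ => Finset.sum_congr rfl fun s _ =>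
    Finset.sum_congr rfl fun a _ => by ring

theorem averageReward_eq_sum_averageOccupancy (T : ℕ) : M.averageReward π s₀ T
    = ∑ s, ∑ a, M.r s a * M.averageOccupancy π s₀ T s a := by
  simp only [averageReward_eq, sum_mul_averageOccupancy, sum_mul_occupancy]

theorem sum_occupancy_succ (t : ℕ) (s : S) :
    ∑ a, M.occupancy π s₀ (t + 1) s a
      = ∑ s', ∑ a, (M.P s' a s).toReal * M.occupancy π s₀ t s' a := by
  rw [sum_mul_occupancy]
  have h1 : ∑ a, M.occupancy π s₀ (t + 1) s a
      = ((M.stateActionLaw π s₀ (t + 1)).map Prod.fst).expect fun x =>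
        (1 / (N : ℝ)) * ∑ i, if x i = s then 1 else 0 := by
    rw [PMF.expect_map]
    simp only [occupancy, ← PMF.expect_sum]
    congr 1
    funext p
    rw [← Finset.mul_sum, Finset.sum_comm]
    congr 1
    refine Finset.sum_congr rfl fun i _ => ?_
    rw [Fintype.sum_bool]
    cases p.2 i <;> simp
  rw [h1, map_fst_stateActionLaw, map_snd_historyLaw_succ, PMF.expect_bind]
  congr 1
  funext p
  rw [PMF.expect_const_mul, PMF.expect_sum]
  congr 1
  refine Finset.sum_congr rfl fun i _ => ?_
  rw [step, expect_indepLaw_apply (fun i => M.P (p.1 i) (p.2 i)) i fun x => if x = s then 1 else 0,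
    PMF.expect_ite_eq]

theorem sum_occupancy (hN : 0 < N) (t : ℕ) : ∑ s, ∑ a, M.occupancy π s₀ t s a = 1 := by
  have h := M.sum_mul_occupancy π s₀ (fun _ _ => 1) t
  have hN' : (N : ℝ) ≠ 0 := by positivity
  simpa [hN', PMF.expect_const] using h

theorem sum_occupancy_true (hN : 0 < N) (hf : M.IsFeasible π s₀) (t : ℕ) :
    ∑ s, M.occupancy π s₀ t s true = M.α := by
  have h := M.sum_mul_occupancy π s₀ (fun _ a => if a = true then 1 else 0) t
  have hN' : (N : ℝ) ≠ 0 := by positivity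
  rw [PMF.expect_congr_support (g := fun _ => M.α), PMF.expect_const] at h
  · simpa using h
  · intro p hp
    have := hf t p hp
    rw [pulls] at this
    rw [Finset.sum_boole, this]
    field_simp

theorem averageOccupancy_nonneg (T : ℕ) (s : S) (a : Bool) : 0 ≤ M.averageOccupancy π s₀ T s a :=
  mul_nonneg (by positivity) (Finset.sum_nonneg fun t _ => M.occupancy_nonneg π s₀ t s a)

theorem sum_averageOccupancy (hN : 0 < N) {T : ℕ} (hT : 0 < T) :
    ∑ s, ∑ a, M.averageOccupancy π s₀ T s a = 1 := by
  have h := M.sum_mul_averageOccupancy π s₀ (fun _ _ => 1) T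
  simp only [one_mul, sum_occupancy M π s₀ hN] at h
  have hT' : (T : ℝ) ≠ 0 := by positivity
  simpa [hT'] using h

theorem averageOccupancy_le_one (hN : 0 < N) (T : ℕ) (s : S) (a : Bool) :
    M.averageOccupancy π s₀ T s a ≤ 1 := by
  rcases Nat.eq_zero_or_pos T with rfl | hT
  · simp [averageOccupancy]
  rw [← M.sum_averageOccupancy π s₀ hN hT]
  exact (Finset.single_le_sum (f := fun a => M.averageOccupancy π s₀ T s a)
    (fun a _ => M.averageOccupancy_nonneg π s₀ T s a) (Finset.mem_univ a)).trans
    (Finset.single_le_sum (f := fun s => ∑ a, M.averageOccupancy π s₀ T s a)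
      (fun s _ => Finset.sum_nonneg fun a _ => M.averageOccupancy_nonneg π s₀ T s a)
      (Finset.mem_univ s))

/-- Conservation of flow holds between consecutive times, so the defect of the time average
telescopes to its end terms. -/
theorem averageOccupancy_balance (T : ℕ) (s : S) :
    ∑ s', ∑ a, M.averageOccupancy π s₀ T s' a * (M.P s' a s).toReal
      - ∑ a, M.averageOccupancy π s₀ T s a
      = (1 / (T : ℝ)) * (∑ a, M.occupancy π s₀ T s a - ∑ a, M.occupancy π s₀ 0 s a) := by
  have h1 : ∑ s', ∑ a, M.averageOccupancy π s₀ T s' a * (M.P s' a s).toReal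
      = (1 / (T : ℝ)) * ∑ t ∈ Finset.range T, ∑ a, M.occupancy π s₀ (t + 1) s a := by
    simp only [sum_occupancy_succ, ← sum_mul_averageOccupancy]
    exact Finset.sum_congr rfl fun _ _ => Finset.sum_congr rfl fun _ _ => mul_comm _ _
  have h2 : ∑ a, M.averageOccupancy π s₀ T s a
      = (1 / (T : ℝ)) * ∑ t ∈ Finset.range T, ∑ a, M.occupancy π s₀ t s a := by
    simp only [averageOccupancy]
    rw [← Finset.mul_sum, Finset.sum_comm]
  rw [h1, h2, ← mul_sub, ← Finset.sum_sub_distrib,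
    Finset.sum_range_sub (fun t => ∑ a, M.occupancy π s₀ t s a)]

theorem abs_sum_occupancy_sub_le (hN : 0 < N) (T : ℕ) (s : S) :
    |∑ a, M.occupancy π s₀ T s a - ∑ a, M.occupancy π s₀ 0 s a| ≤ 1 := by
  have h : ∀ t, 0 ≤ ∑ a, M.occupancy π s₀ t s a ∧ ∑ a, M.occupancy π s₀ t s a ≤ 1 := fun t => by
    refine ⟨Finset.sum_nonneg fun a _ => M.occupancy_nonneg π s₀ t s a, ?_⟩
    rw [← M.sum_occupancy π s₀ hN t]
    exact Finset.single_le_sum (f := fun s => ∑ a, M.occupancy π s₀ t s a)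
      (fun s _ => Finset.sum_nonneg fun a _ => M.occupancy_nonneg π s₀ t s a) (Finset.mem_univ s)
  rw [abs_le]
  constructor <;> linarith [(h T).1, (h T).2, (h 0).1, (h 0).2]

/-- A liminf is at most the limit along any subsequence; along a convergent subsequence of the
averaged occupancies this limit is the reward of a feasible point of the program. -/
theorem liminf_averageReward_le (hN : 0 < N) (hf : M.IsFeasible π s₀) {y : S → Bool → ℝ}
    (hy : M.IsLPOptimal y) :
    liminf (fun T : ℕ => M.averageReward π s₀ T) atTop ≤ ∑ s, ∑ a, M.r s a * y s a := by
  have hcomp : IsCompact (Set.Icc (0 : S → Bool → ℝ) 1) := isCompact_Icc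
  obtain ⟨z, -, φ, hφ, hlim⟩ := hcomp.tendsto_subseq (x := M.averageOccupancy π s₀) fun T =>
    ⟨fun s a => M.averageOccupancy_nonneg π s₀ T s a,
      fun s a => M.averageOccupancy_le_one π s₀ hN T s a⟩
  have hpt : ∀ s a, Tendsto (fun k => M.averageOccupancy π s₀ (φ k) s a) atTop (𝓝 (z s a)) :=
    fun s a => tendsto_pi_nhds.1 (tendsto_pi_nhds.1 hlim s) a
  have hpos : ∀ᶠ k in atTop, 0 < φ k := hφ.tendsto_atTop.eventually_gt_atTop 0
  have hz : M.IsLPFeasible z := by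
    refine ⟨?_, fun s => ?_, ?_, fun s a => ?_⟩
    · refine tendsto_nhds_unique (tendsto_finsetSum _ fun s _ => hpt s true)
        (tendsto_const_nhds.congr' ?_)
      filter_upwards [hpos] with k hk
      have hk' : (φ k : ℝ) ≠ 0 := by positivity
      simp only [averageOccupancy]
      rw [← Finset.mul_sum, Finset.sum_comm]
      simp [sum_occupancy_true M π s₀ hN hf, hk']
    · have h1 : Tendsto (fun k => ∑ s', ∑ a, M.averageOccupancy π s₀ (φ k) s' a * (M.P s' a s).toReal
          - ∑ a, M.averageOccupancy π s₀ (φ k) s a) atTop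
          (𝓝 (∑ s', ∑ a, z s' a * (M.P s' a s).toReal - ∑ a, z s a)) :=
        (tendsto_finsetSum _ fun s' _ => tendsto_finsetSum _ fun a _ => (hpt s' a).mul_const _).sub
          (tendsto_finsetSum _ fun a _ => hpt s a)
      have h2 : Tendsto (fun T : ℕ => 1 / (T : ℝ)) atTop (𝓝 0) := tendsto_one_div_atTop_nhds_zero_nat
      have h3 := h2.comp hφ.tendsto_atTop
      have h4 : Tendsto (fun k => ∑ s', ∑ a, M.averageOccupancy π s₀ (φ k) s' a * (M.P s' a s).toReal
          - ∑ a, M.averageOccupancy π s₀ (φ k) s a) atTop (𝓝 0) := by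
        refine squeeze_zero_norm (fun k => ?_) h3
        rw [averageOccupancy_balance, norm_mul, Real.norm_eq_abs, Real.norm_eq_abs, abs_of_nonneg
          (by positivity)]
        exact mul_le_of_le_one_right (by positivity) (M.abs_sum_occupancy_sub_le π s₀ hN _ s)
      exact sub_eq_zero.1 (tendsto_nhds_unique h1 h4)
    · refine tendsto_nhds_unique
        (tendsto_finsetSum _ fun s _ => tendsto_finsetSum _ fun a _ => hpt s a)
        (tendsto_const_nhds.congr' ?_)
      filter_upwards [hpos] with k hk
      exact (M.sum_averageOccupancy π s₀ hN hk).symm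
    · exact ge_of_tendsto' (hpt s a) fun k => M.averageOccupancy_nonneg π s₀ _ s a
  have hrew : Tendsto (fun k => M.averageReward π s₀ (φ k)) atTop
      (𝓝 (∑ s, ∑ a, M.r s a * z s a)) := by
    simp only [averageReward_eq_sum_averageOccupancy]
    exact tendsto_finsetSum _ fun s _ => tendsto_finsetSum _ fun a _ => (hpt s a).const_mul _
  -- In `ℝ` the liminf is meaningful only for a sequence bounded below.
  have hbdd : IsBoundedUnder (· ≥ ·) atTop fun T : ℕ => M.averageReward π s₀ T := by
    refine isBoundedUnder_of ⟨-∑ s, ∑ a, |M.r s a|, fun T => ?_⟩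
    simp only [averageReward_eq_sum_averageOccupancy, ge_iff_le, ← Finset.sum_neg_distrib]
    refine Finset.sum_le_sum fun s _ => Finset.sum_le_sum fun a _ => ?_
    have h0 := M.averageOccupancy_nonneg π s₀ T s a
    have h1 := M.averageOccupancy_le_one π s₀ hN T s a
    have h2 := neg_abs_le (M.r s a)
    have h3 := abs_nonneg (M.r s a)
    nlinarith
  refine le_trans ?_ (hy.optimal z hz)
  refine le_of_forall_pos_le_add fun ε hε => liminf_le_of_frequently_le ?_ hbdd
  refine hφ.tendsto_atTop.frequently (Eventually.frequently ?_)
  filter_upwards [hrew.eventually (ge_mem_nhds (lt_add_of_pos_right _ hε))] with k hk using hk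

/-- One feasible policy is required so that the supremum is not over the empty set, where `sSup`
takes the default value `0`. -/
theorem optimalReward_le (hN : 0 < N) {π : Policy S N} {s₀ : StateVec S N}
    (hf : M.IsFeasible π s₀) {y : S → Bool → ℝ} (hy : M.IsLPOptimal y) :
    M.optimalReward s₀ ≤ ∑ s, ∑ a, M.r s a * y s a := by
  refine csSup_le ⟨_, π, hf, rfl⟩ ?_
  rintro ρ ⟨π', hf', rfl⟩
  exact M.liminf_averageReward_le π' s₀ hN hf' hy

end BanditModel

/-! ### Cesàro limits of finite Markov chains -/

section Cesaro

/-- The mean ergodic theorem in finite dimension. -/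
theorem exists_tendsto_cesaro {E : Type*} [NormedAddCommGroup E] [NormedSpace ℝ E]
    [FiniteDimensional ℝ E] (K : E →ₗ[ℝ] E) (hK : ∀ x, ‖K x‖ ≤ ‖x‖) (x : E) :
    ∃ u, Tendsto (fun T : ℕ => (1 / (T : ℝ)) • ∑ t ∈ Finset.range T, (K ^ t) x) atTop (𝓝 u) := by
  have hpow : ∀ t x, ‖(K ^ t) x‖ ≤ ‖x‖ := by
    intro t
    induction t with
    | zero => simp
    | succ t ih => intro x; rw [pow_succ']; exact (hK _).trans (ih x)
  have htel : ∀ w (T : ℕ), ∑ t ∈ Finset.range T, (K ^ t) (K w - w) = (K ^ T) w - w := by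
    intro w T
    have : ∀ t, (K ^ t) (K w - w) = (K ^ (t + 1)) w - (K ^ t) w := fun t => by
      rw [map_sub, pow_succ, Module.End.mul_apply]
    simp only [this]
    rw [Finset.sum_range_sub (fun t => (K ^ t) w)]
    simp
  have hlim : ∀ w, Tendsto (fun T : ℕ => (1 / (T : ℝ)) • ((K ^ T) w - w)) atTop (𝓝 0) := by
    intro w
    have h := (tendsto_one_div_atTop_nhds_zero_nat (𝕜 := ℝ)).mul_const (2 * ‖w‖)
    rw [zero_mul] at h
    refine squeeze_zero_norm (fun T => ?_) h
    rw [norm_smul, Real.norm_eq_abs, abs_of_nonneg (by positivity)]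
    refine mul_le_mul_of_nonneg_left ?_ (by positivity)
    linarith [norm_sub_le ((K ^ T) w) w, hpow T w]
  have hfix : ∀ u, K u = u → ∀ t, (K ^ t) u = u := by
    intro u hu t
    induction t with
    | zero => simp
    | succ t ih => rw [pow_succ, Module.End.mul_apply, hu, ih]
  have hconst : ∀ u, K u = u →
      Tendsto (fun T : ℕ => (1 / (T : ℝ)) • ∑ t ∈ Finset.range T, (K ^ t) u) atTop (𝓝 u) := by
    intro u hu
    refine tendsto_const_nhds.congr' ?_
    filter_upwards [eventually_gt_atTop 0] with T hT
    have : (T : ℝ) ≠ 0 := by positivity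
    simp only [hfix u hu, Finset.sum_const, Finset.card_range, ← Nat.cast_smul_eq_nsmul ℝ, smul_smul]
    rw [one_div_mul_cancel this, one_smul]
  -- On a vector of both subspaces the averages are constant, being taken at a fixed point, and tend
  -- to zero, being telescoping sums. By rank-nullity the two subspaces then span `E`.
  have hdisj : Disjoint (LinearMap.ker (K - 1)) (LinearMap.range (K - 1)) := by
    rw [Submodule.disjoint_def]
    rintro u hu ⟨w, hw⟩
    rw [LinearMap.mem_ker, LinearMap.sub_apply, Module.End.one_apply, sub_eq_zero] at hu
    rw [LinearMap.sub_apply, Module.End.one_apply] at hw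
    have h1 := hconst u hu
    rw [← hw] at h1
    simp only [htel] at h1
    rw [hw] at h1
    exact tendsto_nhds_unique h1 (hlim w)
  have hcompl : LinearMap.ker (K - 1) ⊔ LinearMap.range (K - 1) = ⊤ := by
    apply Submodule.eq_top_of_disjoint _ _ _ hdisj
    rw [add_comm, LinearMap.finrank_range_add_finrank_ker]
  obtain ⟨u, hu, v, ⟨w, rfl⟩, rfl⟩ := Submodule.mem_sup.1 (hcompl ▸ Submodule.mem_top (x := x))
  rw [LinearMap.mem_ker, LinearMap.sub_apply, Module.End.one_apply, sub_eq_zero] at hu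
  refine ⟨u, ?_⟩
  have h := (hconst u hu).add (hlim w)
  rw [add_zero] at h
  refine h.congr fun T => ?_
  rw [← smul_add, LinearMap.sub_apply, Module.End.one_apply, ← htel, ← Finset.sum_add_distrib]
  simp only [map_add]

variable {A : Type*} [Fintype A]

/-- The transition operator of a kernel on a finite type. -/
noncomputable def transitionOperator (κ : A → PMF A) : (A → ℝ) →ₗ[ℝ] (A → ℝ) where
  toFun f x := (κ x).expect f
  map_add' f g := by funext x; exact PMF.expect_add _ _ _
  map_smul' c f := by funext x; exact PMF.expect_const_mul _ _ _

theorem transitionOperator_apply (κ : A → PMF A) (f : A → ℝ) (x : A) :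
    transitionOperator κ f x = (κ x).expect f := rfl

theorem norm_transitionOperator_le (κ : A → PMF A) (f : A → ℝ) :
    ‖transitionOperator κ f‖ ≤ ‖f‖ := by
  refine (pi_norm_le_iff_of_nonneg (norm_nonneg f)).2 fun x => ?_
  rw [transitionOperator_apply, Real.norm_eq_abs]
  exact ((κ x).abs_expect_le f).trans
    ((κ x).expect_le_of_support fun z _ => norm_le_pi_norm f z)

/-- Iterated laws of a chain with kernel `κ`. -/
theorem expect_eq_transitionOperator_pow {κ : A → PMF A} {law : ℕ → PMF A} {x : A}
    (h0 : law 0 = PMF.pure x) (hs : ∀ t, law (t + 1) = (law t).bind κ) (t : ℕ) (f : A → ℝ) :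
    (law t).expect f = (transitionOperator κ ^ t) f x := by
  induction t generalizing f with
  | zero => rw [h0, PMF.expect_pure]; simp
  | succ t ih =>
    rw [hs, PMF.expect_bind, pow_succ, Module.End.mul_apply, ← ih]
    rfl

/-- Cesàro limits of expected rewards exist, and are bounded below by Lyapunov drift. -/
theorem exists_tendsto_average_expect {κ : A → PMF A} {law : ℕ → PMF A} {x : A}
    (h0 : law 0 = PMF.pure x) (hs : ∀ t, law (t + 1) = (law t).bind κ) (g V : A → ℝ) {b c : ℝ}
    (hV : ∀ z, c - b * (V z - (κ z).expect V) ≤ g z) :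
    ∃ R, Tendsto (fun T : ℕ => (1 / (T : ℝ)) * ∑ t ∈ Finset.range T, (law t).expect g)
      atTop (𝓝 R) ∧ c ≤ R := by
  obtain ⟨u, hu⟩ := exists_tendsto_cesaro (transitionOperator κ) (norm_transitionOperator_le κ) g
  have hu' := tendsto_pi_nhds.1 hu x
  simp only [Pi.smul_apply, Finset.sum_apply, smul_eq_mul,
    ← expect_eq_transitionOperator_pow h0 hs] at hu'
  refine ⟨u x, hu', ?_⟩
  have hVb : ∀ t, |(law t).expect V| ≤ ‖V‖ := fun t =>
    ((law t).abs_expect_le V).trans ((law t).expect_le_of_support fun z _ => norm_le_pi_norm V z)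
  -- Summing the drift inequality leaves only `b (E V(0) - E V(T)) / T`, which vanishes because `V`
  -- is bounded on a finite type.
  have hlim : Tendsto (fun T : ℕ => c - (1 / (T : ℝ)) * (|b| * (2 * ‖V‖))) atTop (𝓝 c) := by
    have h := (tendsto_one_div_atTop_nhds_zero_nat (𝕜 := ℝ)).mul_const (|b| * (2 * ‖V‖))
    simpa using tendsto_const_nhds.sub h
  refine le_of_tendsto_of_tendsto hlim hu' ?_
  filter_upwards [eventually_gt_atTop 0] with T hT
  have hstep : ∀ t, c - b * ((law t).expect V - (law (t + 1)).expect V) ≤ (law t).expect g := by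
    intro t
    have h := (law t).expect_mono hV
    rwa [PMF.expect_sub, PMF.expect_const, PMF.expect_const_mul, PMF.expect_sub, ← PMF.expect_bind,
      ← hs] at h
  have hsum := Finset.sum_le_sum fun t (_ : t ∈ Finset.range T) => hstep t
  rw [Finset.sum_sub_distrib, ← Finset.mul_sum, Finset.sum_range_sub'] at hsum
  simp only [Finset.sum_const, Finset.card_range, nsmul_eq_mul] at hsum
  have hT' : (0 : ℝ) < T := by exact_mod_cast hT
  have hb : b * ((law 0).expect V - (law T).expect V) ≤ |b| * (2 * ‖V‖) := by
    refine (le_abs_self _).trans ?_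
    rw [abs_mul]
    refine mul_le_mul_of_nonneg_left ?_ (abs_nonneg b)
    linarith [abs_sub ((law 0).expect V) ((law T).expect V), hVb 0, hVb T]
  have : c - 1 / (T : ℝ) * (|b| * (2 * ‖V‖)) = 1 / (T : ℝ) * (T * c - |b| * (2 * ‖V‖)) := by
    field_simp
  rw [this]
  exact mul_le_mul_of_nonneg_left (by linarith) (by positivity)

end Cesaro

/-! ### Stationary policies as Markov chains on state vectors. -/

namespace BanditModel

variable {S : Type*} [Fintype S] (M : BanditModel S) {N : ℕ}

/-- The transition kernel of the state vectors under a stationary policy. -/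
noncomputable def stationaryKernel (q : StateVec S N → PMF (ActionVec N)) (s : StateVec S N) :
    PMF (StateVec S N) :=
  (q s).bind fun a => M.step s a

variable (q : StateVec S N → PMF (ActionVec N)) (s₀ : StateVec S N)

theorem stateActionLaw_stationary (t : ℕ) :
    M.stateActionLaw (fun _ => q) s₀ t
      = ((M.historyLaw (fun _ => q) s₀ t).map Prod.snd).bind fun s => (q s).map fun a => (s, a) := by
  rw [stateActionLaw, PMF.bind_map]
  rfl

theorem historyLaw_stationary_succ (t : ℕ) :
    (M.historyLaw (fun _ => q) s₀ (t + 1)).map Prod.snd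
      = ((M.historyLaw (fun _ => q) s₀ t).map Prod.snd).bind (M.stationaryKernel q) := by
  rw [map_snd_historyLaw_succ, stateActionLaw_stationary, PMF.bind_bind]
  congr 1
  funext s
  rw [PMF.bind_map]
  rfl

theorem averageReward_stationary (T : ℕ) :
    M.averageReward (fun _ => q) s₀ T = (1 / (T : ℝ)) * ∑ t ∈ Finset.range T,
      ((M.historyLaw (fun _ => q) s₀ t).map Prod.snd).expect fun s =>
        (q s).expect fun a => (1 / (N : ℝ)) * ∑ i, M.r (s i) (a i) := by
  rw [averageReward_eq]
  congr 1
  refine Finset.sum_congr rfl fun t _ => ?_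
  rw [stateActionLaw_stationary, PMF.expect_bind]
  simp only [PMF.expect_map]

end BanditModel

/-! ### Exchangeability of the arms -/

section Exchangeability

theorem PMF.map_equiv_uniformOfFinset {A B : Type*} (e : A ≃ B) {F : Finset A} (hF : F.Nonempty)
    {G : Finset B} (hG : G.Nonempty) (h : ∀ x, e x ∈ G ↔ x ∈ F) :
    (PMF.uniformOfFinset F hF).map e = PMF.uniformOfFinset G hG := by
  classical
  have hcard : F.card = G.card := Finset.card_equiv e fun x => (h x).symm
  ext b
  obtain ⟨a, rfl⟩ := e.surjective b
  rw [PMF.map_apply, tsum_eq_single a]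
  · simp [PMF.uniformOfFinset_apply, h, hcard]
  · intro a' ha'
    rw [if_neg]
    exact fun hh => ha' (e.injective hh).symm

variable {N : ℕ} (σ : Equiv.Perm (Fin N))

/-- Relabelling of the coordinates. -/
def relabel (A : Type*) : (Fin N → A) ≃ (Fin N → A) := σ.symm.arrowCongr (Equiv.refl A)

@[simp] theorem relabel_apply {A : Type*} (a : Fin N → A) (i : Fin N) :
    relabel σ A a i = a (σ i) := rfl

theorem map_relabel_indepLaw {A : Type*} [Fintype A] (p : Fin N → PMF A) :
    (indepLaw p).map (relabel σ A) = indepLaw fun i => p (σ i) := by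
  classical
  ext b
  obtain ⟨a, rfl⟩ := (relabel σ A).surjective b
  rw [PMF.map_apply, tsum_eq_single a]
  · simp only [if_true, indepLaw, PMF.ofFintype_apply, relabel_apply]
    exact (Equiv.prod_comp σ fun i => p i (a i)).symm
  · intro a' ha'
    rw [if_neg]
    exact fun hh => ha' ((relabel σ A).injective hh).symm

/-- Relabelling of a set of arms. -/
def relabelSet : Finset (Fin N) ≃ Finset (Fin N) := σ.symm.finsetCongr

@[simp] theorem mem_relabelSet {D : Finset (Fin N)} {i : Fin N} :
    i ∈ relabelSet σ D ↔ σ i ∈ D := by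
  simp [relabelSet, Finset.mem_map_equiv]

theorem card_relabelSet (D : Finset (Fin N)) : (relabelSet σ D).card = D.card := by
  simp [relabelSet]

theorem relabelSet_subset_relabelSet {D D' : Finset (Fin N)} :
    relabelSet σ D ≤ relabelSet σ D' ↔ D ≤ D' := by
  simp [relabelSet]

theorem card_filter_perm (q : Fin N → Prop) [DecidablePred q] :
    (Finset.univ.filter fun i => q (σ i)).card = (Finset.univ.filter q).card :=
  Finset.card_equiv σ (by simp)

theorem card_filter_relabelSet (D : Finset (Fin N)) (q : Fin N → Prop) [DecidablePred q] :
    ((relabelSet σ D).filter fun i => q (σ i)).card = (D.filter q).card :=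
  Finset.card_equiv σ (by simp)

theorem pulls_relabel (a : ActionVec N) : pulls (relabel σ Bool a) = pulls a :=
  card_filter_perm σ fun i => a i = true

theorem matchesOutside_relabel (D : Finset (Fin N)) (ideal a : ActionVec N) :
    matchesOutside (relabelSet σ D) (relabel σ Bool ideal) (relabel σ Bool a)
      = matchesOutside D ideal a := by
  rw [matchesOutside, matchesOutside, ← card_filter_perm σ fun i => i ∉ D ∧ a i = ideal i]
  simp

theorem relabel_mem_completions {b : ℕ} {D : Finset (Fin N)} {ideal a : ActionVec N} :
    relabel σ Bool a ∈ completions b (relabelSet σ D) (relabel σ Bool ideal)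
      ↔ a ∈ completions b D ideal := by
  simp only [completions, Finset.mem_filter, Finset.mem_univ, true_and, pulls_relabel,
    mem_relabelSet, relabel_apply]
  rw [σ.forall_congr_left]
  simp

theorem relabel_mem_rectified {b : ℕ} {D : Finset (Fin N)} {ideal a : ActionVec N} :
    relabel σ Bool a ∈ rectified b (relabelSet σ D) (relabel σ Bool ideal)
      ↔ a ∈ rectified b D ideal := by
  have h1 : ((relabelSet σ D).filter fun i => relabel σ Bool ideal i = true).card
      = (D.filter fun i => ideal i = true).card := card_filter_relabelSet σ D fun i => ideal i = true
  unfold rectified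
  rw [h1, card_relabelSet]
  split_ifs
  · simp only [Finset.mem_filter, Finset.mem_univ, true_and, pulls_relabel, mem_relabelSet,
      relabel_apply]
    rw [σ.forall_congr_left]
    simp
  · simp only [Finset.mem_filter, Finset.mem_univ, true_and, pulls_relabel, mem_relabelSet,
      relabel_apply]
    rw [σ.forall_congr_left]
    simp
  · simp only [Finset.mem_filter, relabel_mem_completions]
    -- The competitors in the maximality condition are themselves reindexed by the relabelling.
    rw [(relabel σ Bool).symm.forall_congr_left]
    simp only [Equiv.symm_symm, relabel_mem_completions, matchesOutside_relabel]

theorem stateCount_relabel {S : Type*} [DecidableEq S] (s : StateVec S N) (D : Finset (Fin N)) :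
    stateCount (relabel σ S s) (relabelSet σ D) = stateCount s D := by
  funext z
  exact congrArg (fun n : ℕ => (n : ℝ) / N) (card_filter_relabelSet σ D fun i => s i = z)

/-- Equal counts make the fibres over each state equinumerous; bijections between the fibres glue to
a permutation of the arms. -/
theorem exists_relabel_eq {S : Type*} [DecidableEq S] {s s' : StateVec S N}
    (h : stateCount s Finset.univ = stateCount s' Finset.univ) :
    ∃ σ : Equiv.Perm (Fin N), s' = relabel σ S s := by
  rcases Nat.eq_zero_or_pos N with rfl | hN
  · exact ⟨1, funext fun i => i.elim0⟩
  have hcard : ∀ z, Fintype.card {i // s' i = z} = Fintype.card {i // s i = z} := fun z => by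
    have hz := congrFun h z
    have hN' : (N : ℝ) ≠ 0 := by positivity
    simp only [stateCount] at hz
    rw [div_left_inj' hN', Nat.cast_inj] at hz
    rw [Fintype.card_subtype, Fintype.card_subtype, hz]
  let e : ∀ z, {i // s' i = z} ≃ {i // s i = z} := fun z => Fintype.equivOfCardEq (hcard z)
  refine ⟨(Equiv.sigmaFiberEquiv s').symm.trans
    ((Equiv.sigmaCongrRight e).trans (Equiv.sigmaFiberEquiv s)), ?_⟩
  funext i
  rw [relabel_apply]
  exact ((e (s' i)) ⟨i, rfl⟩).2.symm

end Exchangeability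

/-! ### The Markov property of the state counts. -/

namespace BanditModel

variable {S : Type*} [Fintype S] (M : BanditModel S) {N : ℕ}

theorem map_relabel_step (σ : Equiv.Perm (Fin N)) (s : StateVec S N) (a : ActionVec N) :
    (M.step s a).map (relabel σ S) = M.step (relabel σ S s) (relabel σ Bool a) :=
  map_relabel_indepLaw σ _

/-- Functions of the state that determine the law of their next value form a Markov chain. -/
theorem isMarkovChainUnder_stationary {E : Type*} {f : StateVec S N → E}
    {q : StateVec S N → PMF (ActionVec N)}
    (h : ∀ s s', f s = f s' → (M.stationaryKernel q s).map f = (M.stationaryKernel q s').map f) :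
    M.IsMarkovChainUnder f fun _ => q := by
  classical
  refine ⟨fun e => if he : ∃ s, f s = e then (M.stationaryKernel q he.choose).map f
    else PMF.pure e, fun s₀ t => ?_⟩
  simp only [observedLaw, historyLaw, PMF.map_bind, PMF.bind_map, PMF.map_comp]
  congr 1
  funext p
  have he : ∃ s, f s = f p.2 := ⟨p.2, rfl⟩
  simp only [Function.comp_apply]
  rw [dif_pos he, h _ _ he.choose_spec]
  simp only [stationaryKernel, PMF.map_bind, PMF.map_comp]
  congr 1
  funext a
  congr 1
  funext s'
  simp

variable [DecidableEq S]

theorem slack_relabel (σ : Equiv.Perm (Fin N)) (μ : S → ℝ) (s : StateVec S N)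
    (D : Finset (Fin N)) : M.slack μ (relabel σ S s) (relabelSet σ D) = M.slack μ s D := by
  simp only [slack, stateCount_relabel, fraction, card_relabelSet]

theorem isOptimalSet_relabel (σ : Equiv.Perm (Fin N)) (Q : Matrix S S ℝ) (μ : S → ℝ)
    (s : StateVec S N) (D : Finset (Fin N)) :
    M.IsOptimalSet Q μ (relabel σ S s) (relabelSet σ D) ↔ M.IsOptimalSet Q μ s D := by
  unfold IsOptimalSet
  rw [(relabelSet σ).symm.forall_congr_left]
  simp only [Equiv.symm_symm, slack_relabel, hW, stateCount_relabel, fraction, card_relabelSet]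

theorem relabelSet_mem_maximalOptimalSets (σ : Equiv.Perm (Fin N)) (Q : Matrix S S ℝ) (μ : S → ℝ)
    (s : StateVec S N) (D : Finset (Fin N)) :
    relabelSet σ D ∈ M.maximalOptimalSets Q μ (relabel σ S s) ↔ D ∈ M.maximalOptimalSets Q μ s := by
  simp only [maximalOptimalSets, Finset.mem_filter, Finset.mem_univ, true_and]
  simp only [Maximal, isOptimalSet_relabel]
  rw [(relabelSet σ).symm.forall_congr_left]
  simp only [Equiv.symm_symm, isOptimalSet_relabel, relabelSet_subset_relabelSet]

variable (y : S → Bool → ℝ) (hy : ∀ s a, 0 ≤ y s a) (μ : S → ℝ)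

/-- Each of the three random choices is equivariant: the uniform laws because the sets of candidates
are permuted, the ideal actions because they depend on an arm only through its state. Uniform
tie-breaking is essential here. -/
theorem map_relabel_setOptPolicy (σ : Equiv.Perm (Fin N)) (s : StateVec S N) :
    (M.setOptPolicy y hy μ N [] s).map (relabel σ Bool)
      = M.setOptPolicy y hy μ N [] (relabel σ S s) := by
  simp only [setOptPolicy, PMF.map_bind]
  rw [← PMF.map_equiv_uniformOfFinset (relabelSet σ) (M.maximalOptimalSets_nonempty _ μ s)
    (M.maximalOptimalSets_nonempty _ μ _)
    (M.relabelSet_mem_maximalOptimalSets σ (M.singleArmMatrix y) μ s), PMF.bind_map]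
  congr 1
  funext D
  simp only [Function.comp_apply, relabel_apply]
  rw [← map_relabel_indepLaw σ fun i => singleArmPolicy y hy (s i), PMF.bind_map]
  congr 1
  funext ideal
  exact PMF.map_equiv_uniformOfFinset (relabel σ Bool) (rectified_nonempty (M.budget_le N) D ideal)
    (rectified_nonempty (M.budget_le N) _ _) fun a => relabel_mem_rectified σ

theorem map_relabel_stationaryKernel (σ : Equiv.Perm (Fin N)) (s : StateVec S N) :
    (M.stationaryKernel (M.setOptPolicy y hy μ N []) s).map (relabel σ S)
      = M.stationaryKernel (M.setOptPolicy y hy μ N []) (relabel σ S s) := by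
  simp only [stationaryKernel]
  rw [PMF.map_bind, ← map_relabel_setOptPolicy, PMF.bind_map]
  simp only [map_relabel_step]
  rfl

theorem isMarkovChainUnder_setOptPolicy :
    M.IsMarkovChainUnder (fun s : StateVec S N => stateCount s Finset.univ)
      (M.setOptPolicy y hy μ N) := by
  refine M.isMarkovChainUnder_stationary (q := M.setOptPolicy y hy μ N []) fun s s' h => ?_
  obtain ⟨σ, rfl⟩ := exists_relabel_eq h
  rw [← map_relabel_stationaryKernel, PMF.map_comp]
  congr 1
  funext s'
  have := stateCount_relabel σ s' Finset.univ
  have hu : relabelSet σ Finset.univ = (Finset.univ : Finset (Fin N)) := by ext; simp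
  rw [hu] at this
  exact this.symm

end BanditModel

/-! ### Geometry of focus sets -/

section Geometry

variable {S : Type*} [DecidableEq S] {N : ℕ}

theorem stateCount_eq_sum (s : StateVec S N) (D : Finset (Fin N)) (z : S) :
    stateCount s D z = (1 / (N : ℝ)) * ∑ i ∈ D, if s i = z then 1 else 0 := by
  rw [stateCount, Finset.sum_boole]
  ring

theorem fraction_nonneg (D : Finset (Fin N)) : 0 ≤ fraction D := by unfold fraction; positivity

theorem fraction_le_one (D : Finset (Fin N)) : fraction D ≤ 1 := by
  refine div_le_one_of_le₀ ?_ (Nat.cast_nonneg N)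
  exact_mod_cast (by simpa using Finset.card_le_univ D)

theorem fraction_sdiff {D D' : Finset (Fin N)} (h : D ⊆ D') :
    fraction (D' \ D) = fraction D' - fraction D := by
  simp only [fraction, Finset.card_sdiff_of_subset h, Nat.cast_sub (Finset.card_le_card h)]
  ring

theorem fraction_univ (hN : 0 < N) : fraction (Finset.univ : Finset (Fin N)) = 1 := by
  have : (N : ℝ) ≠ 0 := by positivity
  simp [fraction, this]

theorem stateCount_nonneg (s : StateVec S N) (D : Finset (Fin N)) (z : S) :
    0 ≤ stateCount s D z := by
  unfold stateCount; positivity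

theorem stateCount_sdiff (s : StateVec S N) {D D' : Finset (Fin N)} (h : D ⊆ D') :
    stateCount s (D' \ D) = stateCount s D' - stateCount s D := by
  funext z
  simp only [stateCount_eq_sum, Pi.sub_apply, ← Finset.sum_sdiff h]
  ring

variable [Fintype S]

theorem sum_stateCount_mul (s : StateVec S N) (D : Finset (Fin N)) (f : S → ℝ) :
    ∑ z, stateCount s D z * f z = (1 / (N : ℝ)) * ∑ i ∈ D, f (s i) := by
  simp only [stateCount_eq_sum, mul_assoc, ← Finset.mul_sum, Finset.sum_mul]
  rw [Finset.sum_comm]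
  simp

theorem sum_stateCount (s : StateVec S N) (D : Finset (Fin N)) :
    ∑ z, stateCount s D z = fraction D := by
  have := sum_stateCount_mul s D fun _ => 1
  simp only [mul_one, Finset.sum_const, nsmul_eq_mul] at this
  rw [this, fraction]
  ring

/-- The deviation `x(D) - m(D) μ` of the state count on `D` from `μ`. -/
noncomputable def deviation (μ : S → ℝ) (s : StateVec S N) (D : Finset (Fin N)) : S → ℝ :=
  stateCount s D - fraction D • μ

variable {Q : Matrix S S ℝ} {μ : S → ℝ}

theorem sum_deviation (hμ : ∑ s, μ s = 1) (s : StateVec S N) (D : Finset (Fin N)) :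
    ∑ z, deviation μ s D z = 0 := by
  simp [deviation, Finset.sum_sub_distrib, sum_stateCount, ← Finset.mul_sum, hμ]

theorem l1Norm_prob (h0 : ∀ s, 0 ≤ μ s) (hμ : ∑ s, μ s = 1) : l1Norm μ = 1 := by
  simp only [l1Norm, abs_of_nonneg (h0 _), hμ]

theorem l1Norm_deviation_le (h0 : ∀ s, 0 ≤ μ s) (hμ : ∑ s, μ s = 1) (s : StateVec S N)
    (D : Finset (Fin N)) : l1Norm (deviation μ s D) ≤ 2 * fraction D := by
  refine (l1Norm_sub_le _ _).trans_eq ?_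
  rw [l1Norm_smul, l1Norm_prob h0 hμ, abs_of_nonneg (fraction_nonneg D), l1Norm]
  simp only [abs_of_nonneg (stateCount_nonneg s D _), sum_stateCount]
  ring

theorem deviation_sdiff (s : StateVec S N) {D D' : Finset (Fin N)} (h : D ⊆ D') :
    deviation μ s (D' \ D) = deviation μ s D' - deviation μ s D := by
  simp only [deviation, stateCount_sdiff s h, fraction_sdiff h, sub_smul]
  abel

theorem l1Norm_deviation_le_of_subset (h0 : ∀ s, 0 ≤ μ s) (hμ : ∑ s, μ s = 1) (s : StateVec S N)
    {D D' : Finset (Fin N)} (h : D ⊆ D') :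
    l1Norm (deviation μ s D') ≤ l1Norm (deviation μ s D) + 2 * (fraction D' - fraction D) := by
  rw [← fraction_sdiff h, ← add_sub_cancel (deviation μ s D) (deviation μ s D'), ← deviation_sdiff s h]
  exact (l1Norm_add_le _ _).trans (add_le_add_right (l1Norm_deviation_le h0 hμ _ _) _)

end Geometry

/-! ### Feasible sets, coverage, and the Lyapunov function. -/

namespace BanditModel

variable {S : Type*} [Fintype S] [DecidableEq S] (M : BanditModel S) {N : ℕ}

theorem β_pos : 0 < M.β := lt_min M.α_pos (sub_pos.2 M.α_lt_one)

theorem β_le_half : M.β ≤ 1 / 2 := by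
  have h1 : M.β ≤ M.α := min_le_left _ _
  have h2 : M.β ≤ 1 - M.α := min_le_right _ _
  linarith

theorem slack_eq (μ : S → ℝ) (s : StateVec S N) (D : Finset (Fin N)) :
    M.slack μ s D = M.β * (1 - fraction D) - (1 / 2) * l1Norm (deviation μ s D) := rfl

theorem hW_eq (Q : Matrix S S ℝ) (μ : S → ℝ) (s : StateVec S N) (D : Finset (Fin N)) :
    hW Q μ s D = weightedNorm (weightMatrix Q μ) (deviation μ s D) := rfl

variable {Q : Matrix S S ℝ} {μ : S → ℝ}

theorem lipschitzW_nonneg : 0 ≤ lipschitzW Q μ := mul_nonneg (by norm_num) (Real.sqrt_nonneg _)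

/-- `Q` is the transition matrix of an aperiodic unichain, and `μ` a probability distribution. -/
structure IsErgodicPair (Q : Matrix S S ℝ) (μ : S → ℝ) : Prop where
  stochastic : Q ∈ Matrix.rowStochastic ℝ S
  aperiodic : IsAperiodicUnichain Q
  nonneg : ∀ s, 0 ≤ μ s
  total : ∑ s, μ s = 1

theorem IsErgodicPair.nonempty (h : IsErgodicPair Q μ) : Nonempty S :=
  let ⟨i, _⟩ := h.aperiodic.1.1
  ⟨i⟩

theorem IsErgodicPair.one_le_lambdaW (h : IsErgodicPair Q μ) : 1 ≤ lambdaW Q μ :=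
  have := h.nonempty
  _root_.one_le_lambdaW h.stochastic h.aperiodic h.total

theorem IsErgodicPair.weightedNorm_add_le (h : IsErgodicPair Q μ) (v w : S → ℝ) :
    weightedNorm (weightMatrix Q μ) (v + w)
      ≤ weightedNorm (weightMatrix Q μ) v + √(lambdaW Q μ) * l1Norm w :=
  (_root_.weightedNorm_add_le (weightMatrix_posSemidef h.stochastic h.aperiodic h.total) v w).trans
    (add_le_add_right (weightedNorm_le_l1Norm (zero_le_one.trans h.one_le_lambdaW) w) _)

/-- The source of the factor `2` in `L_W`: a set of arms of fraction `m` has deviation at most `2 m`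
in `ℓ¹`. -/
theorem IsErgodicPair.sqrt_mul_l1Norm_deviation_le (h : IsErgodicPair Q μ) (s : StateVec S N)
    (D : Finset (Fin N)) :
    √(lambdaW Q μ) * l1Norm (deviation μ s D) ≤ lipschitzW Q μ * fraction D := by
  have := mul_le_mul_of_nonneg_left (l1Norm_deviation_le h.nonneg h.total s D)
    (Real.sqrt_nonneg (lambdaW Q μ))
  rw [lipschitzW]
  linarith

/-- The deviation is additive over disjoint sets, so only the added arms contribute to the increase.
Consequently enlarging a set never raises the objective `h_W + L_W (1 - m)`. -/
theorem IsErgodicPair.hW_le_of_subset (h : IsErgodicPair Q μ) (s : StateVec S N)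
    {D D' : Finset (Fin N)} (hD : D ⊆ D') :
    hW Q μ s D' ≤ hW Q μ s D + lipschitzW Q μ * (fraction D' - fraction D) := by
  rw [hW_eq, hW_eq, ← fraction_sdiff hD,
    ← add_sub_cancel (deviation μ s D) (deviation μ s D'), ← deviation_sdiff s hD]
  exact (h.weightedNorm_add_le _ _).trans (add_le_add_right (h.sqrt_mul_l1Norm_deviation_le s _) _)

theorem IsErgodicPair.hW_le_of_superset (h : IsErgodicPair Q μ) (s : StateVec S N)
    {D D' : Finset (Fin N)} (hD : D ⊆ D') :
    hW Q μ s D ≤ hW Q μ s D' + lipschitzW Q μ * (fraction D' - fraction D) := by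
  have h1 : deviation μ s D = deviation μ s D' + (-1 : ℝ) • deviation μ s (D' \ D) := by
    rw [deviation_sdiff s hD, neg_one_smul]
    abel
  rw [hW_eq, hW_eq, h1, ← fraction_sdiff hD]
  refine (h.weightedNorm_add_le _ _).trans (add_le_add_right ?_ _)
  rw [l1Norm_smul, abs_neg, abs_one, one_mul]
  exact h.sqrt_mul_l1Norm_deviation_le s _

/-- A maximal optimal set cannot be enlarged, and so has little slack. -/
theorem IsErgodicPair.coverage (h : IsErgodicPair Q μ) (hN : 0 < N) {s : StateVec S N}
    {D : Finset (Fin N)} (hD : D ∈ M.maximalOptimalSets Q μ s) :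
    M.β * (1 - fraction D) ≤ 1 / 2 * l1Norm (deviation μ s D) + (1 + M.β) / N := by
  simp only [maximalOptimalSets, Finset.mem_filter, Finset.mem_univ, true_and] at hD
  have hN' : (0 : ℝ) < N := by exact_mod_cast hN
  by_contra! hlt
  have hpos : 0 < M.β * (1 - fraction D) := by
    refine lt_of_le_of_lt ?_ hlt
    have := l1Norm_nonneg (deviation μ s D)
    have := M.β_nonneg
    positivity
  have hne : D ≠ Finset.univ := by
    rintro rfl
    rw [fraction_univ hN] at hpos
    simp at hpos
  obtain ⟨i, hi⟩ : ∃ i, i ∉ D := by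
    by_contra! hall
    exact hne (Finset.eq_univ_iff_forall.2 hall)
  have hsub : D ⊆ insert i D := Finset.subset_insert i D
  have hfr : fraction (insert i D) - fraction D = 1 / N := by
    simp only [fraction, Finset.card_insert_of_notMem hi]
    push_cast
    ring
  have hl := l1Norm_deviation_le_of_subset h.nonneg h.total s hsub
  -- One more arm lowers `β (1 - m)` by `β / N` and raises the `ℓ¹` deviation by at most `2 / N`, so
  -- the slack drops by at most `(1 + β) / N`.
  have hfeas : 0 ≤ M.slack μ s (insert i D) := by
    rw [hfr] at hl
    rw [slack_eq]
    have h1 : fraction (insert i D) = fraction D + 1 / N := by linarith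
    have h2 : (1 + M.β) / N = 1 / N + M.β * (1 / N) := by ring
    rw [h1]
    rw [h2] at hlt
    nlinarith
  have hopt : M.IsOptimalSet Q μ s (insert i D) := by
    refine ⟨hfeas, fun D' hD' => le_trans ?_ (hD.1.2 D' hD')⟩
    have := h.hW_le_of_subset s hsub
    linarith
  exact hi (hD.2 hopt hsub (Finset.mem_insert_self i D))

theorem exists_subset_filter_card {s : StateVec S N} {D : Finset (Fin N)} {k : S → ℕ}
    (hk : ∀ z, k z ≤ (D.filter fun i => s i = z).card) :
    ∃ D' ⊆ D, ∀ z, (D'.filter fun i => s i = z).card = k z := by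
  choose T hT hc using fun z => Finset.exists_subset_card_eq (hk z)
  refine ⟨Finset.univ.biUnion T, fun i hi => ?_, fun z => ?_⟩
  · obtain ⟨z, -, hz⟩ := Finset.mem_biUnion.1 hi
    exact (Finset.mem_filter.1 (hT z hz)).1
  · rw [← hc z]
    congr 1
    ext i
    simp only [Finset.mem_filter, Finset.mem_biUnion, Finset.mem_univ, true_and]
    constructor
    · rintro ⟨⟨z', hz'⟩, rfl⟩
      have := (Finset.mem_filter.1 (hT z' hz')).2
      rwa [this]
    · exact fun hi => ⟨⟨z, hi⟩, (Finset.mem_filter.1 (hT z hi)).2⟩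

/-- A set can be made feasible by shrinking it in proportion to its lack of slack. -/
theorem exists_subset_slack_nonneg (hN : 0 < N) (hμ0 : ∀ s, 0 ≤ μ s) (hμ : ∑ s, μ s = 1)
    (s : StateVec S N) (D : Finset (Fin N)) {e : ℝ} (he0 : 0 ≤ e) (he : -e ≤ M.slack μ s D) :
    ∃ D' ⊆ D, 0 ≤ M.slack μ s D' ∧ fraction D - fraction D' ≤
      (e + Fintype.card S / N) / M.β + Fintype.card S / N := by
  have hN' : (0 : ℝ) < N := by exact_mod_cast hN
  have hβ := M.β_pos
  set n : ℝ := Fintype.card S / N with hn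
  have hn0 : 0 ≤ n := by positivity
  have hdiv : 0 ≤ (e + n) / M.β := by positivity
  -- For few arms the claimed bound exceeds `1`, and the empty set suffices. Otherwise `n < β`,
  -- which is what makes `ε ≤ 1` below.
  by_cases hbig : M.β ≤ n
  · refine ⟨∅, Finset.empty_subset D, ?_, ?_⟩
    · simp [slack, fraction, stateCount, M.β_nonneg]
    · have h1 : 1 ≤ (e + n) / M.β := by rw [one_le_div hβ]; linarith
      have h2 := fraction_le_one D
      have h3 : fraction (∅ : Finset (Fin N)) = 0 := by simp [fraction]
      linarith
  push Not at hbig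
  -- Scaling all counts by `1 - ε` without rounding would leave slack at least `β - (1 - ε)(β + e) =
  -- ε (β + e) - e`, since `β m(D) + ½ ‖dev‖₁ ≤ β + e`. This `ε` makes it equal to `n`, the largest
  -- possible cost of rounding down.
  set ε : ℝ := (e + n) / (M.β + e) with hε
  have hβe : 0 < M.β + e := by linarith
  have hε0 : 0 ≤ ε := by positivity
  have hε1 : ε ≤ 1 := by rw [hε, div_le_one hβe]; linarith
  have hεeq : ε * (M.β + e) = e + n := div_mul_cancel₀ _ hβe.ne'
  have hεle : ε ≤ (e + n) / M.β := div_le_div_of_nonneg_left (by linarith) hβ (by linarith)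
  let c : S → ℕ := fun z => (D.filter fun i => s i = z).card
  have hc0 : ∀ z, 0 ≤ (1 - ε) * c z := fun z => mul_nonneg (by linarith) (Nat.cast_nonneg _)
  obtain ⟨D', hD', hk⟩ := exists_subset_filter_card (s := s) (D := D)
    (k := fun z => ⌊(1 - ε) * c z⌋₊) (fun z => Nat.floor_le_of_le (by
      have : (0 : ℝ) ≤ c z := Nat.cast_nonneg _
      change (1 - ε) * (c z : ℝ) ≤ (c z : ℝ)
      nlinarith))
  -- The rounding error: each coordinate lies in `[-1/N, 0]`.
  let w : S → ℝ := stateCount s D' - (1 - ε) • stateCount s D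
  have hw : ∀ z, w z = ((⌊(1 - ε) * c z⌋₊ : ℝ) - (1 - ε) * c z) / N := fun z => by
    simp only [w, Pi.sub_apply, Pi.smul_apply, smul_eq_mul, stateCount, hk, c]
    ring
  have hw0 : ∀ z, w z ≤ 0 := fun z => by
    rw [hw]
    exact div_nonpos_of_nonpos_of_nonneg (sub_nonpos.2 (Nat.floor_le (hc0 z))) hN'.le
  have hw1 : ∀ z, -(1 / N) ≤ w z := fun z => by
    rw [hw, ← neg_div]
    refine div_le_div_of_nonneg_right ?_ hN'.le
    linarith [Nat.lt_floor_add_one ((1 - ε) * c z)]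
  have hsum : ∑ z, w z = fraction D' - (1 - ε) * fraction D := by
    simp only [w, Pi.sub_apply, Pi.smul_apply, smul_eq_mul, Finset.sum_sub_distrib,
      ← Finset.mul_sum, sum_stateCount]
  have hl1 : l1Norm w ≤ n := by
    have h1 : ∀ z ∈ Finset.univ, |w z| ≤ 1 / (N : ℝ) := fun z _ => by
      rw [abs_of_nonpos (hw0 z)]; linarith [hw1 z]
    refine (Finset.sum_le_sum h1).trans_eq ?_
    simp [hn, div_eq_mul_inv]
  have hwsum : |∑ z, w z| ≤ n := (Finset.abs_sum_le_sum_abs _ _).trans hl1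
  have hwsum0 : ∑ z, w z ≤ 0 := Finset.sum_nonpos fun z _ => hw0 z
  have hdev : deviation μ s D' = (1 - ε) • deviation μ s D + (w - (∑ z, w z) • μ) := by
    rw [hsum]
    funext z
    simp only [deviation, w, Pi.add_apply, Pi.sub_apply, Pi.smul_apply, smul_eq_mul]
    ring
  have hl2 : l1Norm (deviation μ s D') ≤ (1 - ε) * l1Norm (deviation μ s D) + 2 * n := by
    rw [hdev]
    refine (l1Norm_add_le _ _).trans ?_
    have h1 := l1Norm_sub_le w ((∑ z, w z) • μ)
    rw [l1Norm_smul, l1Norm_prob hμ0 hμ, mul_one] at h1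
    rw [l1Norm_smul, abs_of_nonneg (by linarith)]
    linarith
  have hfrac := fraction_le_one D
  have hfrac0 := fraction_nonneg D
  refine ⟨D', hD', ?_, ?_⟩
  · rw [slack_eq] at he ⊢
    have h1 : fraction D' ≤ (1 - ε) * fraction D := by linarith
    have h2 : M.β * fraction D' ≤ M.β * ((1 - ε) * fraction D) :=
      mul_le_mul_of_nonneg_left h1 hβ.le
    have h3 : (1 - ε) * (1 / 2 * l1Norm (deviation μ s D))
        ≤ (1 - ε) * (M.β * (1 - fraction D) + e) :=
      mul_le_mul_of_nonneg_left (by linarith) (by linarith)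
    nlinarith
  · have h1 := (abs_le.1 hwsum).1
    have h2 : ε * fraction D ≤ ε := mul_le_of_le_one_right hε0 hfrac
    linarith

/-- The optimal value `min_D h_W(x, D) + L_W (1 - m(D))` over the feasible sets. -/
noncomputable def lyapunov (Q : Matrix S S ℝ) (μ : S → ℝ) (s : StateVec S N) : ℝ :=
  hW Q μ s (M.maximalOptimalSets_nonempty Q μ s).choose
    + lipschitzW Q μ * (1 - fraction (M.maximalOptimalSets_nonempty Q μ s).choose)

theorem lyapunov_le {s : StateVec S N} {D : Finset (Fin N)} (hD : 0 ≤ M.slack μ s D) :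
    M.lyapunov Q μ s ≤ hW Q μ s D + lipschitzW Q μ * (1 - fraction D) := by
  have h := (M.maximalOptimalSets_nonempty Q μ s).choose_spec
  simp only [maximalOptimalSets, Finset.mem_filter, Finset.mem_univ, true_and] at h
  exact h.1.2 D hD

theorem slack_nonneg_of_mem_maximalOptimalSets {s : StateVec S N} {D : Finset (Fin N)}
    (hD : D ∈ M.maximalOptimalSets Q μ s) : 0 ≤ M.slack μ s D := by
  simp only [maximalOptimalSets, Finset.mem_filter, Finset.mem_univ, true_and] at hD
  exact hD.1.1

/-- All maximal optimal sets attain the same value, so the choice inside `lyapunov` is immaterial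
and the identity applies to whichever focus set is drawn. -/
theorem lyapunov_eq {s : StateVec S N} {D : Finset (Fin N)}
    (hD : D ∈ M.maximalOptimalSets Q μ s) :
    M.lyapunov Q μ s = hW Q μ s D + lipschitzW Q μ * (1 - fraction D) := by
  refine le_antisymm (M.lyapunov_le (M.slack_nonneg_of_mem_maximalOptimalSets hD)) ?_
  simp only [maximalOptimalSets, Finset.mem_filter, Finset.mem_univ, true_and] at hD
  exact hD.1.2 _ (M.slack_nonneg_of_mem_maximalOptimalSets
    (M.maximalOptimalSets_nonempty Q μ s).choose_spec)

/-- The Lyapunov function after a step, in terms of the distance of the new state count on `D` from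
its expectation when all arms of `D` follow `Q`. -/
theorem IsErgodicPair.lyapunov_next_le (h : IsErgodicPair Q μ) (hst : Matrix.vecMul μ Q = μ)
    (hN : 0 < N) {s : StateVec S N} {D : Finset (Fin N)}
    (hD : D ∈ M.maximalOptimalSets Q μ s) (s' : StateVec S N) {e : ℝ}
    (he : e = l1Norm (stateCount s' D - Matrix.vecMul (stateCount s D) Q)) :
    M.lyapunov Q μ s' ≤ M.lyapunov Q μ s - 1 / (2 * lambdaW Q μ) * hW Q μ s D
      + √(lambdaW Q μ) * e + 2 * lipschitzW Q μ *
        ((1 / 2 * e + Fintype.card S / N) / M.β + Fintype.card S / N) := by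
  have := h.nonempty
  have hdev : deviation μ s' D = Matrix.vecMul (deviation μ s D) Q
      + (stateCount s' D - Matrix.vecMul (stateCount s D) Q) := by
    simp only [deviation, Matrix.sub_vecMul, Matrix.smul_vecMul, hst]
    abel
  have he0 : 0 ≤ e := he ▸ l1Norm_nonneg _
  -- A stochastic matrix does not increase the `ℓ¹` norm, so with `m(D)` unchanged only the noise
  -- can consume slack.
  have hslack : -(1 / 2 * e) ≤ M.slack μ s' D := by
    have h1 := M.slack_nonneg_of_mem_maximalOptimalSets hD
    have h2 := l1Norm_add_le (Matrix.vecMul (deviation μ s D) Q)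
      (stateCount s' D - Matrix.vecMul (stateCount s D) Q)
    have h3 := l1Norm_vecMul_le h.stochastic (deviation μ s D)
    rw [← hdev, ← he] at h2
    rw [slack_eq] at h1 ⊢
    linarith
  obtain ⟨D', hD', hs', hm⟩ := M.exists_subset_slack_nonneg hN h.nonneg h.total s' D
    (by linarith) hslack
  have h1 := M.lyapunov_le (Q := Q) hs'
  -- Shrinking `D` to `D'` raises both `h_W` and `L_W (1 - m)` by at most `L_W (m(D) - m(D'))`,
  -- hence the factor `2 L_W`.
  have h2 := h.hW_le_of_superset s' hD'
  have h3 : hW Q μ s' D ≤ (1 - 1 / (2 * lambdaW Q μ)) * hW Q μ s D + √(lambdaW Q μ) * e := by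
    rw [hW_eq, hdev, he]
    exact (h.weightedNorm_add_le _ _).trans (add_le_add_left
      (weightedNorm_vecMul_le h.stochastic h.aperiodic h.total (sum_deviation h.total s D)) _)
  rw [M.lyapunov_eq hD]
  have h4 := mul_le_mul_of_nonneg_left hm (lipschitzW_nonneg (Q := Q) (μ := μ))
  linarith

end BanditModel

/-! ### Rectification -/

section Rectify

variable {N : ℕ}

/-- The number of arms of `D` that do not take their ideal action. -/
def mismatches (D : Finset (Fin N)) (ideal a : ActionVec N) : ℕ :=
  (D.filter fun i => a i ≠ ideal i).card

theorem mismatches_add_le_card (D : Finset (Fin N)) (ideal a : ActionVec N) :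
    (Finset.univ.filter fun i => a i ≠ ideal i).card ≤ mismatches D ideal a + (N - D.card) := by
  have h : (Finset.univ.filter fun i => a i ≠ ideal i)
      ⊆ (D.filter fun i => a i ≠ ideal i) ∪ Dᶜ := by
    intro i hi
    by_cases hD : i ∈ D <;> simp_all
  have := (Finset.card_le_card h).trans (Finset.card_union_le _ _)
  rwa [Finset.card_compl, Fintype.card_fin] at this

theorem pulls_of_mem_rectified {b : ℕ} {D : Finset (Fin N)} {ideal a : ActionVec N}
    (h : a ∈ rectified b D ideal) : pulls a = b := by
  unfold rectified completions at h
  split_ifs at h <;> simp only [Finset.mem_filter, Finset.mem_univ, true_and] at h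
  · exact h.1
  · exact h.1
  · exact h.1.1

/-- Rectification changes few ideal actions in `D` if the number of ideal pulls in `D` is close to
the range compatible with the budget. -/
theorem mismatches_le {b : ℕ} {D : Finset (Fin N)} {ideal a : ActionVec N}
    (h : a ∈ rectified b D ideal) {κ : ℝ} (h1 : κ ≤ b) (h2 : (b : ℝ) + D.card - N ≤ κ) :
    (mismatches D ideal a : ℝ) ≤ |((D.filter fun i => ideal i = true).card : ℝ) - κ| := by
  have hpulls := pulls_of_mem_rectified h
  unfold rectified at h
  split_ifs at h with hc1 hc2
  · simp only [Finset.mem_filter, Finset.mem_univ, true_and] at h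
    -- Too many ideal pulls: the mismatches in `D` are ideal pulls that are not carried out, at most
    -- the count minus `b`, and `κ ≤ b`.
    have hsub : (Finset.univ.filter fun i => a i = true) ⊆ D.filter fun i => ideal i = true := by
      intro i hi
      simp only [Finset.mem_filter, Finset.mem_univ, true_and] at hi
      simpa using h.2 i hi
    have heq : (D.filter fun i => a i ≠ ideal i)
        ⊆ (D.filter fun i => ideal i = true) \ Finset.univ.filter fun i => a i = true := by
      intro i hi
      have hi2 := h.2 i
      simp only [Finset.mem_filter, Finset.mem_sdiff, Finset.mem_univ, true_and] at hi ⊢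
      cases ha : a i <;> cases hd : ideal i <;> simp_all
    have hle := Finset.card_le_card heq
    rw [Finset.card_sdiff_of_subset hsub] at hle
    change _ ≤ _ - pulls a at hle
    rw [hpulls] at hle
    have hle' : (mismatches D ideal a : ℝ) ≤ (D.filter fun i => ideal i = true).card - b := by
      rw [← Nat.cast_sub hc1]
      exact_mod_cast hle
    exact (hle'.trans (by linarith)).trans (le_abs_self _)
  · simp only [Finset.mem_filter, Finset.mem_univ, true_and] at h
    -- Too few ideal pulls: the mismatches are ideal idlings turned into pulls. Their number is at
    -- most `b + |D| - N` minus the count, and `b + |D| - N ≤ κ`.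
    have hsub : (Finset.univ.filter fun i => a i = false) ⊆ D.filter fun i => ideal i = false := by
      intro i hi
      simp only [Finset.mem_filter, Finset.mem_univ, true_and] at hi
      simpa using h.2 i hi
    have heq : (D.filter fun i => a i ≠ ideal i)
        ⊆ (D.filter fun i => ideal i = false) \ Finset.univ.filter fun i => a i = false := by
      intro i hi
      have hi2 := h.2 i
      simp only [Finset.mem_filter, Finset.mem_sdiff, Finset.mem_univ, true_and] at hi ⊢
      cases ha : a i <;> cases hd : ideal i <;> simp_all
    have hle := Finset.card_le_card heq
    rw [Finset.card_sdiff_of_subset hsub] at hle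
    have h3 := Finset.card_filter_add_card_filter_not (s := D) (fun i => ideal i = true)
    have h4 := Finset.card_filter_add_card_filter_not (s := (Finset.univ : Finset (Fin N)))
      (fun i => a i = true)
    simp only [Bool.not_eq_true, Finset.card_univ, Fintype.card_fin] at h3 h4
    change pulls a + _ = N at h4
    have hle2 : mismatches D ideal a + (D.filter fun i => ideal i = true).card + N ≤ b + D.card := by
      unfold mismatches
      omega
    have hle' : (mismatches D ideal a : ℝ) + (D.filter fun i => ideal i = true).card + N
        ≤ b + D.card := by exact_mod_cast hle2
    refine le_trans ?_ (neg_le_abs _)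
    linarith
  · simp only [completions, Finset.mem_filter, Finset.mem_univ, true_and] at h
    have : mismatches D ideal a = 0 := by
      rw [mismatches, Finset.card_eq_zero, Finset.filter_eq_empty_iff]
      exact fun i hi => by simpa using h.1.2 i hi
    rw [this, Nat.cast_zero]
    exact abs_nonneg _

end Rectify

/-! ### Fluctuations -/

section Fluctuation

variable {S A : Type*} [Fintype S] [Fintype A] {N : ℕ}

/-- The expected `ℓ¹` norm of a vector with small second moments. -/
theorem expect_l1Norm_le {p : PMF A} {v : A → S → ℝ} {c : ℝ}
    (h : ∑ z, p.expect (fun x => v x z ^ 2) ≤ c) :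
    p.expect (fun x => l1Norm (v x)) ≤ √(Fintype.card S) * √c := by
  classical
  have h1 : p.expect (fun x => l1Norm (v x))
      ≤ √(Fintype.card S) * p.expect fun x => √(∑ z, v x z ^ 2) := by
    rw [← PMF.expect_const_mul]
    exact p.expect_mono fun x => l1Norm_le_sqrt_card_mul_sqrt (v x)
  refine h1.trans (mul_le_mul_of_nonneg_left (p.expect_le_sqrt ?_) (Real.sqrt_nonneg _))
  simp only [Real.sq_sqrt (Finset.sum_nonneg fun _ _ => sq_nonneg _), PMF.expect_sum]
  exact h

/-- Fluctuations of the average over `D` of independent substochastic vectors. -/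
theorem expect_l1Norm_centred_le (hN : 0 < N) (p : Fin N → PMF A) (D : Finset (Fin N))
    (g : Fin N → A → S → ℝ) (h0 : ∀ i x z, 0 ≤ g i x z) (h1 : ∀ i x, ∑ z, g i x z = 1) :
    (indepLaw p).expect (fun a => l1Norm fun z =>
        (1 / (N : ℝ)) * ∑ i ∈ D, (g i (a i) z - (p i).expect fun x => g i x z))
      ≤ √(Fintype.card S) * (1 / √N) := by
  have hN' : (0 : ℝ) < N := by exact_mod_cast hN
  have hle1 : ∀ i x z, g i x z ≤ 1 := fun i x z => by
    rw [← h1 i x]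
    exact Finset.single_le_sum (fun z _ => h0 i x z) (Finset.mem_univ z)
  have h : ∑ z, (indepLaw p).expect (fun a =>
      ((1 / (N : ℝ)) * ∑ i ∈ D, (g i (a i) z - (p i).expect fun x => g i x z)) ^ 2) ≤ 1 / N := by
    -- Since `0 ≤ g ≤ 1`, second moments are at most first moments. These sum to `1` over `z`, so
    -- the total variance carries no factor `|S|`.
    have hz : ∀ z, (indepLaw p).expect (fun a =>
        ((1 / (N : ℝ)) * ∑ i ∈ D, (g i (a i) z - (p i).expect fun x => g i x z)) ^ 2)
        ≤ (1 / (N : ℝ)) ^ 2 * ∑ i ∈ D, (p i).expect fun x => g i x z := fun z => by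
      simp only [mul_pow, PMF.expect_const_mul]
      refine mul_le_mul_of_nonneg_left ?_ (by positivity)
      refine (expect_indepLaw_centred_sq_le p D fun i x => g i x z).trans
        (Finset.sum_le_sum fun i _ => (p i).expect_mono fun x => ?_)
      have := h0 i x z
      have := hle1 i x z
      nlinarith
    refine (Finset.sum_le_sum fun z _ => hz z).trans ?_
    rw [← Finset.mul_sum, Finset.sum_comm]
    simp only [← PMF.expect_sum, h1, PMF.expect_const, Finset.sum_const, nsmul_eq_mul, mul_one]
    have hD : (D.card : ℝ) ≤ N := by exact_mod_cast (by simpa using Finset.card_le_univ D)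
    calc (1 / (N : ℝ)) ^ 2 * D.card ≤ (1 / (N : ℝ)) ^ 2 * N :=
          mul_le_mul_of_nonneg_left hD (by positivity)
      _ = 1 / N := by field_simp
  refine (expect_l1Norm_le h).trans_eq ?_
  rw [Real.sqrt_div zero_le_one, Real.sqrt_one]

end Fluctuation

/-! ### The optimal single-armed policy -/

namespace BanditModel

variable {S : Type*} {y : S → Bool → ℝ}

theorem singleArmProb_nonneg (hy : ∀ s a, 0 ≤ y s a) (s : S) (a : Bool) :
    0 ≤ singleArmProb y s a := by
  unfold singleArmProb
  split_ifs with h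
  · exact div_nonneg (hy s a) h.le
  · norm_num

theorem sum_singleArmProb (s : S) : ∑ a, singleArmProb y s a = 1 := by
  rw [Fintype.sum_bool]
  unfold singleArmProb
  split_ifs with h
  · rw [← add_div, add_comm, div_self h.ne']
  · norm_num

/-- Where the default `1/2` applies, both entries of `y` vanish, so the default does no harm. -/
theorem sum_mul_singleArmProb (hy : ∀ s a, 0 ≤ y s a) (s : S) (a : Bool) :
    (∑ a, y s a) * singleArmProb y s a = y s a := by
  rw [Fintype.sum_bool, add_comm]
  unfold singleArmProb
  split_ifs with h
  · exact mul_div_cancel₀ _ h.ne'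
  · have h1 := hy s true
    have h2 := hy s false
    have h3 : y s true = 0 := by linarith
    have h4 : y s false = 0 := by linarith
    cases a <;> simp [h3, h4]

theorem expect_singleArmPolicy (hy : ∀ s a, 0 ≤ y s a) (s : S) (f : Bool → ℝ) :
    (singleArmPolicy y hy s).expect f = ∑ a, singleArmProb y s a * f a := by
  simp only [PMF.expect, singleArmPolicy, PMF.ofFintype_apply,
    ENNReal.toReal_ofReal (singleArmProb_nonneg hy s _)]

variable [Fintype S] [DecidableEq S] (M : BanditModel S) {μ : S → ℝ}

theorem singleArmMatrix_apply (hy : ∀ s a, 0 ≤ y s a) (s s' : S) :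
    M.singleArmMatrix y s s' = (singleArmPolicy y hy s).expect fun a => (M.P s a s').toReal := by
  rw [expect_singleArmPolicy]
  rfl

theorem singleArmMatrix_mem_rowStochastic (hy : ∀ s a, 0 ≤ y s a) :
    M.singleArmMatrix y ∈ Matrix.rowStochastic ℝ S := by
  rw [mem_rowStochastic_sum]
  refine ⟨fun s s' => ?_, fun s => ?_⟩
  · rw [M.singleArmMatrix_apply hy]
    exact PMF.expect_nonneg _ fun a => ENNReal.toReal_nonneg
  · simp only [M.singleArmMatrix_apply hy, ← PMF.expect_sum, PMF.sum_toReal, PMF.expect_const]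

/-- The balance constraint is exactly stationarity of the state marginal of `y`. With uniqueness of
the stationary distribution, that marginal is `μ`. -/
theorem IsLPFeasible.isStationaryDist (hy : M.IsLPFeasible y) :
    IsStationaryDist (M.singleArmMatrix y) fun s => ∑ a, y s a := by
  refine ⟨fun s => Finset.sum_nonneg fun a _ => hy.nonneg s a, hy.total, ?_⟩
  funext s
  rw [← hy.balance s]
  simp only [Matrix.vecMul, dotProduct, singleArmMatrix, Matrix.of_apply]
  refine Finset.sum_congr rfl fun s' _ => ?_
  rw [Finset.mul_sum]
  refine Finset.sum_congr rfl fun a _ => ?_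
  rw [← mul_assoc, sum_mul_singleArmProb hy.nonneg]

/-- The stationary distribution and the single-armed policy recover the solution of the linear
program. -/
theorem IsLPFeasible.mul_singleArmProb (hy : M.IsLPFeasible y)
    (hchain : IsAperiodicUnichain (M.singleArmMatrix y))
    (hμ : IsStationaryDist (M.singleArmMatrix y) μ) (s : S) (a : Bool) :
    μ s * singleArmProb y s a = y s a := by
  rw [hμ.unique (M.singleArmMatrix_mem_rowStochastic hy.nonneg) hchain hy.isStationaryDist]
  exact sum_mul_singleArmProb hy.nonneg s a

/-! ### One step of the set-optimization policy -/

variable {N : ℕ} (hy : ∀ s a, 0 ≤ y s a)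

/-- The law of the ideal actions. -/
noncomputable def idealLaw (s : StateVec S N) : PMF (ActionVec N) :=
  indepLaw fun i => singleArmPolicy y hy (s i)

/-- The law of the actions, given the focus set and the ideal actions. -/
noncomputable def rectifiedLaw (D : Finset (Fin N)) (ideal : ActionVec N) : PMF (ActionVec N) :=
  PMF.uniformOfFinset (rectified (M.budget N) D ideal) (rectified_nonempty (M.budget_le N) D ideal)

/-- Deviations have total mass zero, so `f` may be replaced by `f - 1/2`, which is at most `1/2` in
absolute value. Hence the `½` in the slack. -/
theorem sum_deviation_mul_abs_le (hμ : ∑ s, μ s = 1) (s : StateVec S N) (D : Finset (Fin N))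
    {f : S → ℝ} (h0 : ∀ z, 0 ≤ f z) (h1 : ∀ z, f z ≤ 1) :
    |∑ z, deviation μ s D z * f z| ≤ 1 / 2 * l1Norm (deviation μ s D) := by
  have h : ∑ z, deviation μ s D z * f z = ∑ z, deviation μ s D z * (f z - 1 / 2) := by
    simp only [mul_sub, Finset.sum_sub_distrib, ← Finset.sum_mul, sum_deviation hμ]
    ring
  rw [h, l1Norm, Finset.mul_sum]
  refine (Finset.abs_sum_le_sum_abs _ _).trans (Finset.sum_le_sum fun z _ => ?_)
  rw [abs_mul, mul_comm]
  refine mul_le_mul_of_nonneg_right ?_ (abs_nonneg _)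
  rw [abs_le]
  constructor <;> linarith [h0 z, h1 z]

theorem budget_eq (hint : ∃ b : ℕ, (b : ℝ) = M.α * N) : (M.budget N : ℝ) = M.α * N := by
  obtain ⟨b, hb⟩ := hint
  rw [budget, ← hb, Nat.floor_natCast]

/-- With nonnegative slack, the mean number `κ` of ideal pulls in `D` lies between `αN - (N - |D|)`
and `αN`. Mismatches are then controlled by the distance of the actual number from `κ`, whose
variance is at most `N`. -/
theorem expect_mismatches_le (hN : 0 < N) (hint : ∃ b : ℕ, (b : ℝ) = M.α * N)
    (hμ : ∑ s, μ s = 1) (hα : ∑ s, μ s * singleArmProb y s true = M.α)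
    {s : StateVec S N} {D : Finset (Fin N)} (hD : 0 ≤ M.slack μ s D) :
    (idealLaw hy s).expect (fun ideal => (M.rectifiedLaw D ideal).expect fun a =>
      (1 / (N : ℝ)) * mismatches D ideal a) ≤ 1 / √N := by
  have hN' : (0 : ℝ) < N := by exact_mod_cast hN
  set κ : ℝ := ∑ i ∈ D, singleArmProb y (s i) true with hκ
  have hprob1 : ∀ z, singleArmProb y z true ≤ 1 := fun z => by
    rw [← sum_singleArmProb (y := y) z]
    exact Finset.single_le_sum (fun a _ => singleArmProb_nonneg hy z a) (Finset.mem_univ true)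
  -- Under `μ` an arm is pulled with probability `α`, so `κ / N` is `m(D) α` up to a term that the
  -- slack condition bounds by `β (1 - m(D))`.
  have hκ' : κ = N * (∑ z, deviation μ s D z * singleArmProb y z true + fraction D * M.α) := by
    have h := sum_stateCount_mul s D fun z => singleArmProb y z true
    have h2 : ∑ z, deviation μ s D z * singleArmProb y z true
        = ∑ z, stateCount s D z * singleArmProb y z true - fraction D * M.α := by
      rw [← hα, Finset.mul_sum, ← Finset.sum_sub_distrib]
      refine Finset.sum_congr rfl fun z _ => ?_
      simp only [deviation, Pi.sub_apply, Pi.smul_apply, smul_eq_mul]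
      ring
    rw [h2, h, ← hκ]
    field_simp
    ring
  have hdev := (sum_deviation_mul_abs_le hμ s D (fun z => singleArmProb_nonneg hy z true) hprob1).trans
    (show _ ≤ M.β * (1 - fraction D) by rw [slack_eq] at hD; linarith)
  obtain ⟨hdev1, hdev2⟩ := abs_le.1 hdev
  have hm : 0 ≤ 1 - fraction D := sub_nonneg.2 (fraction_le_one D)
  have hβ1 : M.β * (1 - fraction D) ≤ M.α * (1 - fraction D) :=
    mul_le_mul_of_nonneg_right (min_le_left _ _) hm
  have hβ2 : M.β * (1 - fraction D) ≤ (1 - M.α) * (1 - fraction D) :=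
    mul_le_mul_of_nonneg_right (min_le_right _ _) hm
  have hcard : (D.card : ℝ) = N * fraction D := by rw [fraction]; field_simp
  have hb1 : κ ≤ M.budget N := by
    rw [M.budget_eq hint, hκ', mul_comm M.α]
    exact mul_le_mul_of_nonneg_left (by linarith) hN'.le
  have hb2 : (M.budget N : ℝ) + D.card - N ≤ κ := by
    rw [M.budget_eq hint, hκ', hcard]
    have : M.α * N + N * fraction D - N = N * (M.α + fraction D - 1) := by ring
    rw [this]
    exact mul_le_mul_of_nonneg_left (by linarith) hN'.le
  have hk : ∀ ideal : ActionVec N, ((D.filter fun i => ideal i = true).card : ℝ) - κ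
      = ∑ i ∈ D, ((if ideal i = true then (1 : ℝ) else 0)
        - (singleArmPolicy y hy (s i)).expect fun a => if a = true then 1 else 0) := fun ideal => by
    rw [Finset.sum_sub_distrib, Finset.sum_boole, hκ]
    simp [expect_singleArmPolicy]
  have hstep : ∀ ideal, (M.rectifiedLaw D ideal).expect (fun a =>
      (1 / (N : ℝ)) * mismatches D ideal a)
      ≤ (1 / (N : ℝ)) * |((D.filter fun i => ideal i = true).card : ℝ) - κ| := fun ideal => by
    refine PMF.expect_le_of_support _ fun a ha => ?_
    rw [rectifiedLaw, PMF.mem_support_uniformOfFinset_iff] at ha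
    exact mul_le_mul_of_nonneg_left (mismatches_le ha hb1 hb2) (by positivity)
  refine (PMF.expect_mono _ hstep).trans ?_
  rw [PMF.expect_const_mul]
  have hvar : (idealLaw hy s).expect (fun ideal =>
      |((D.filter fun i => ideal i = true).card : ℝ) - κ|) ≤ √N := by
    refine PMF.expect_le_sqrt _ ?_
    simp only [sq_abs, hk]
    refine (expect_indepLaw_centred_sq_le _ D
      fun _ (a : Bool) => if a = true then (1 : ℝ) else 0).trans ?_
    have h1 : ∀ i ∈ D, (singleArmPolicy y hy (s i)).expect
        (fun a : Bool => (if a = true then (1 : ℝ) else 0) ^ 2) ≤ 1 := fun i _ =>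
      PMF.expect_le_of_support _ fun a _ => by split_ifs <;> norm_num
    refine (Finset.sum_le_sum h1).trans ?_
    simp only [Finset.sum_const, nsmul_eq_mul, mul_one]
    exact_mod_cast (by simpa using Finset.card_le_univ D)
  refine (mul_le_mul_of_nonneg_left hvar (by positivity)).trans_eq ?_
  rw [one_div_mul_eq_div, Real.sqrt_div_self']

/-- The noise has three sources: the random transitions (`F1`), the actions changed by rectification
(`F2`) and the sampling of ideal actions (`F3`). `F1` and `F3` contribute `√|S| / √N` each. In `F2`
each mismatch changes a next-state law by at most `2` in `ℓ¹`, for a total of `2 / √N ≤ 2 √|S| /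
√N`. -/
theorem expect_l1Norm_stateCount_sub_le (hN : 0 < N) (hint : ∃ b : ℕ, (b : ℝ) = M.α * N)
    [Nonempty S]
    (hμ : ∑ s, μ s = 1) (hα : ∑ s, μ s * singleArmProb y s true = M.α)
    {s : StateVec S N} {D : Finset (Fin N)} (hD : 0 ≤ M.slack μ s D) :
    (idealLaw hy s).expect (fun ideal => (M.rectifiedLaw D ideal).expect fun a =>
      (M.step s a).expect fun s' =>
        l1Norm (stateCount s' D - Matrix.vecMul (stateCount s D) (M.singleArmMatrix y)))
      ≤ 4 * √(Fintype.card S) * (1 / √N) := by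
  have hN' : (0 : ℝ) < N := by exact_mod_cast hN
  let F1 : ActionVec N → StateVec S N → S → ℝ := fun a s' z =>
    (1 / (N : ℝ)) * ∑ i ∈ D, ((if s' i = z then (1 : ℝ) else 0)
      - (M.P (s i) (a i)).expect fun x => if x = z then 1 else 0)
  let F2 : ActionVec N → ActionVec N → S → ℝ := fun ideal a z =>
    (1 / (N : ℝ)) * ∑ i ∈ D, ((M.P (s i) (a i) z).toReal - (M.P (s i) (ideal i) z).toReal)
  let F3 : ActionVec N → S → ℝ := fun ideal z =>
    (1 / (N : ℝ)) * ∑ i ∈ D, ((M.P (s i) (ideal i) z).toReal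
      - (singleArmPolicy y hy (s i)).expect fun a => (M.P (s i) a z).toReal)
  have hdecomp : ∀ ideal a s', stateCount s' D - Matrix.vecMul (stateCount s D) (M.singleArmMatrix y)
      = F1 a s' + F2 ideal a + F3 ideal := by
    intro ideal a s'
    funext z
    have h := sum_stateCount_mul s D fun z' => M.singleArmMatrix y z' z
    simp only [M.singleArmMatrix_apply hy] at h
    simp only [Pi.sub_apply, Pi.add_apply, Matrix.vecMul, dotProduct, h, stateCount_eq_sum s' D z,
      F1, F2, F3, PMF.expect_ite_eq, M.singleArmMatrix_apply hy, Finset.sum_sub_distrib]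
    ring
  have h1 : ∀ a, (M.step s a).expect (fun s' => l1Norm (F1 a s'))
      ≤ √(Fintype.card S) * (1 / √N) := fun a =>
    expect_l1Norm_centred_le hN (fun i => M.P (s i) (a i)) D
      (fun _ x z => if x = z then 1 else 0) (fun _ x z => by split_ifs <;> norm_num)
      (fun _ x => by simp)
  have h3 : (idealLaw hy s).expect (fun ideal => l1Norm (F3 ideal))
      ≤ √(Fintype.card S) * (1 / √N) :=
    expect_l1Norm_centred_le hN (fun i => singleArmPolicy y hy (s i)) D
      (fun i a z => (M.P (s i) a z).toReal) (fun _ _ _ => ENNReal.toReal_nonneg)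
      (fun i a => PMF.sum_toReal _)
  have h2 : ∀ ideal a, l1Norm (F2 ideal a) ≤ 2 * ((1 / (N : ℝ)) * mismatches D ideal a) := by
    intro ideal a
    have hz : ∀ z ∈ Finset.univ, |F2 ideal a z| ≤ (1 / (N : ℝ)) * ∑ i ∈ D, if a i ≠ ideal i then
        (M.P (s i) (a i) z).toReal + (M.P (s i) (ideal i) z).toReal else 0 := by
      intro z _
      simp only [F2]
      rw [abs_mul, abs_of_nonneg (by positivity : (0 : ℝ) ≤ 1 / N)]
      refine mul_le_mul_of_nonneg_left ((Finset.abs_sum_le_sum_abs _ _).trans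
        (Finset.sum_le_sum fun i _ => ?_)) (by positivity)
      split_ifs with hne
      · refine (abs_sub _ _).trans_eq ?_
        rw [abs_of_nonneg ENNReal.toReal_nonneg, abs_of_nonneg ENNReal.toReal_nonneg]
      · rw [not_not] at hne
        simp [hne]
    refine (Finset.sum_le_sum hz).trans_eq ?_
    rw [← Finset.mul_sum, Finset.sum_comm, mul_left_comm]
    congr 1
    rw [mismatches, ← Finset.sum_boole, Finset.mul_sum]
    refine Finset.sum_congr rfl fun i _ => ?_
    split_ifs
    · rw [Finset.sum_add_distrib, PMF.sum_toReal, PMF.sum_toReal]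
      norm_num
    · simp
  have hpt : ∀ ideal a, (M.step s a).expect (fun s' =>
        l1Norm (stateCount s' D - Matrix.vecMul (stateCount s D) (M.singleArmMatrix y)))
      ≤ (√(Fintype.card S) * (1 / √N) + l1Norm (F3 ideal))
        + 2 * ((1 / (N : ℝ)) * mismatches D ideal a) := by
    intro ideal a
    have hle : ∀ s', l1Norm (stateCount s' D - Matrix.vecMul (stateCount s D) (M.singleArmMatrix y))
        ≤ l1Norm (F1 a s') + (l1Norm (F2 ideal a) + l1Norm (F3 ideal)) := fun s' => by
      rw [hdecomp ideal a s']
      linarith [l1Norm_add_le (F1 a s' + F2 ideal a) (F3 ideal),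
        l1Norm_add_le (F1 a s') (F2 ideal a)]
    refine ((M.step s a).expect_mono hle).trans ?_
    rw [PMF.expect_add, PMF.expect_const]
    linarith [h1 a, h2 ideal a]
  have hE := (idealLaw hy s).expect_mono fun ideal =>
    (M.rectifiedLaw D ideal).expect_mono (hpt ideal)
  simp only [PMF.expect_add, PMF.expect_const, PMF.expect_const_mul _ 2] at hE
  have hmis := M.expect_mismatches_le hy hN hint hμ hα hD
  have hcard : 1 ≤ √(Fintype.card S) := by
    rw [Real.one_le_sqrt]
    exact_mod_cast Fintype.card_pos
  have hu : 0 ≤ 1 / √(N : ℝ) := by positivity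
  nlinarith

/-- If all arms took their ideal actions, the reward would differ from the program's value only
through the deviation of the whole population, at most that of `D` plus `2 (1 - m(D))`.
Rectification changes the mismatched arms of `D` and at most all arms outside `D`, at a cost of `2
r_max` each. -/
theorem expect_reward_ge (hN : 0 < N) (hint : ∃ b : ℕ, (b : ℝ) = M.α * N)
    (hμ0 : ∀ s, 0 ≤ μ s) (hμ : ∑ s, μ s = 1)
    (hμy : ∀ s a, μ s * singleArmProb y s a = y s a) (hα : ∑ s, y s true = M.α)
    {s : StateVec S N} {D : Finset (Fin N)} (hD : 0 ≤ M.slack μ s D) :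
    ∑ z, ∑ a, M.r z a * y z a
      - M.rMax * (l1Norm (deviation μ s D) + 4 * (1 - fraction D) + 2 * (1 / √N))
      ≤ (idealLaw hy s).expect fun ideal => (M.rectifiedLaw D ideal).expect fun a =>
        (1 / (N : ℝ)) * ∑ i, M.r (s i) (a i) := by
  have hN' : (0 : ℝ) < N := by exact_mod_cast hN
  have hr0 : 0 ≤ M.rMax := Real.iSup_nonneg fun _ => abs_nonneg _
  let rbar : S → ℝ := fun z => (singleArmPolicy y hy z).expect (M.r z)
  have hrbar : ∀ z, |rbar z| ≤ M.rMax := fun z =>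
    (PMF.abs_expect_le _ _).trans (PMF.expect_le_of_support _ fun a _ => M.abs_r_le_rMax z a)
  have hideal : (idealLaw hy s).expect (fun ideal => (1 / (N : ℝ)) * ∑ i, M.r (s i) (ideal i))
      = ∑ z, ∑ a, M.r z a * y z a + ∑ z, deviation μ s Finset.univ z * rbar z := by
    rw [PMF.expect_const_mul, PMF.expect_sum]
    have h1 : ∀ i, (idealLaw hy s).expect (fun ideal => M.r (s i) (ideal i)) = rbar (s i) :=
      fun i => expect_indepLaw_apply (fun i => singleArmPolicy y hy (s i)) i (M.r (s i))
    simp only [h1]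
    rw [← sum_stateCount_mul s Finset.univ rbar, ← Finset.sum_add_distrib]
    refine Finset.sum_congr rfl fun z _ => ?_
    have h2 : ∑ a, M.r z a * y z a = μ z * rbar z := by
      simp only [rbar, expect_singleArmPolicy, Finset.mul_sum, ← hμy]
      exact Finset.sum_congr rfl fun a _ => by ring
    rw [h2]
    simp only [deviation, fraction_univ hN, Pi.sub_apply, one_smul]
    ring
  have hdev : |∑ z, deviation μ s Finset.univ z * rbar z|
      ≤ M.rMax * (l1Norm (deviation μ s D) + 2 * (1 - fraction D)) := by
    have h1 := l1Norm_deviation_le_of_subset hμ0 hμ s (Finset.subset_univ D)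
    rw [fraction_univ hN] at h1
    refine le_trans ?_ (mul_le_mul_of_nonneg_left h1 hr0)
    rw [l1Norm, Finset.mul_sum]
    refine (Finset.abs_sum_le_sum_abs _ _).trans (Finset.sum_le_sum fun z _ => ?_)
    rw [abs_mul, mul_comm]
    exact mul_le_mul_of_nonneg_right (hrbar z) (abs_nonneg _)
  have hpt : ∀ ideal a : ActionVec N, (1 / (N : ℝ)) * ∑ i, M.r (s i) (ideal i)
      - 2 * M.rMax * ((1 / (N : ℝ)) * mismatches D ideal a + (1 - fraction D))
      ≤ (1 / (N : ℝ)) * ∑ i, M.r (s i) (a i) := by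
    intro ideal a
    have h1 : ∑ i, (M.r (s i) (ideal i) - M.r (s i) (a i))
        ≤ ∑ i, if a i ≠ ideal i then 2 * M.rMax else 0 := by
      refine Finset.sum_le_sum fun i _ => ?_
      split_ifs with hne
      · linarith [(abs_le.1 (M.abs_r_le_rMax (s i) (ideal i))).2,
          (abs_le.1 (M.abs_r_le_rMax (s i) (a i))).1]
      · rw [not_not] at hne
        simp [hne]
    rw [← Finset.sum_filter, Finset.sum_const, nsmul_eq_mul, Finset.sum_sub_distrib] at h1
    have h2 : ((Finset.univ.filter fun i => a i ≠ ideal i).card : ℝ)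
        ≤ mismatches D ideal a + (N - D.card) := by
      have h := mismatches_add_le_card D ideal a
      have hDN : D.card ≤ N := by simpa using Finset.card_le_univ D
      rw [← Nat.cast_sub hDN]
      exact_mod_cast h
    have h3 : ((Finset.univ.filter fun i => a i ≠ ideal i).card : ℝ) * (2 * M.rMax)
        ≤ (mismatches D ideal a + (N - D.card)) * (2 * M.rMax) :=
      mul_le_mul_of_nonneg_right h2 (by linarith)
    have h4 := mul_le_mul_of_nonneg_left (h1.trans h3) (by positivity : (0 : ℝ) ≤ 1 / N)
    have h5 : (1 / (N : ℝ)) * ((mismatches D ideal a + (N - D.card)) * (2 * M.rMax))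
        = 2 * M.rMax * ((1 / (N : ℝ)) * mismatches D ideal a + (1 - fraction D)) := by
      rw [fraction]
      field_simp
    rw [h5, mul_sub] at h4
    linarith
  have hE := (idealLaw hy s).expect_mono fun ideal =>
    (M.rectifiedLaw D ideal).expect_mono (hpt ideal)
  simp only [PMF.expect_sub, PMF.expect_add, PMF.expect_const, PMF.expect_const_mul _ (2 * M.rMax)]
    at hE
  rw [hideal] at hE
  have hmis := M.expect_mismatches_le hy hN hint hμ
    (by rw [← hα]; exact Finset.sum_congr rfl fun s _ => hμy s true) hD
  have h6 := mul_le_mul_of_nonneg_left hmis (by linarith : 0 ≤ 2 * M.rMax)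
  have h7 := (abs_le.1 hdev).1
  linarith

end BanditModel

/-! ### The one-step inequality between reward and drift, and the theorem. -/

namespace BanditModel

/-- The numerical bound on the drift and reward errors, with `u = 1 / √N`, `k = √|S|` and
`l = √λ_W`. -/
theorem error_bound {u k l β R : ℝ} (hu0 : 0 ≤ u) (hu1 : u ≤ 1) (hk : 1 ≤ k) (hl : 1 ≤ l)
    (hβ : 0 < β) (hβ2 : β ≤ 1 / 2) (hR : 0 ≤ R) :
    2 * l ^ 2 * (R * (k * (1 + 2 / β))) *
        (l * (4 * k * u) + 2 * (2 * l) * ((1 / 2 * (4 * k * u) + k ^ 2 * u ^ 2) / β + k ^ 2 * u ^ 2))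
      + R * (4 * ((1 + β) * u ^ 2 / β) + 2 * u)
      ≤ 252 * R * (l ^ 2) ^ 2 * (k ^ 2) ^ 2 / β ^ 2 * u := by
  set c : ℝ := 1 / β with hc
  have hc2 : 2 ≤ c := by rw [hc, le_div_iff₀ hβ]; linarith
  have hcβ : β * c = 1 := mul_one_div_cancel hβ.ne'
  have hdiv : ∀ x : ℝ, x / β = x * c := fun x => by rw [hc, mul_one_div]
  have hdiv2 : ∀ x : ℝ, x / β ^ 2 = x * c ^ 2 := fun x => by rw [hc]; field_simp
  simp only [hdiv, hdiv2]
  have hkk : k ≤ k ^ 2 := by nlinarith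
  have huu : u ^ 2 ≤ u := by nlinarith
  have hk2 : 1 ≤ k ^ 2 := by nlinarith
  have hl2 : 1 ≤ l ^ 2 := by nlinarith
  have hku : k * u ≤ k ^ 2 * u := mul_le_mul_of_nonneg_right hkk hu0
  have hku2 : k ^ 2 * u ^ 2 ≤ k ^ 2 * u := mul_le_mul_of_nonneg_left huu (by positivity)
  have hX : 0 ≤ k ^ 2 * u := by positivity
  -- Everything is reduced to the monomial `k² u c`, using `k ≤ k²`, `u² ≤ u` and `2 ≤ c = 1/β`.
  have h1 : l * (4 * k * u) + 2 * (2 * l) * ((1 / 2 * (4 * k * u) + k ^ 2 * u ^ 2) * c + k ^ 2 * u ^ 2)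
      ≤ l * (16 * (k ^ 2 * u) * c) := by
    have e1 : (1 / 2 * (4 * k * u) + k ^ 2 * u ^ 2) * c ≤ 3 * (k ^ 2 * u) * c :=
      mul_le_mul_of_nonneg_right (by linarith) (by linarith)
    have e2 : 2 * (k ^ 2 * u) ≤ (k ^ 2 * u) * c := by nlinarith
    have e3 : 4 * k * u + 4 * ((1 / 2 * (4 * k * u) + k ^ 2 * u ^ 2) * c + k ^ 2 * u ^ 2)
        ≤ 16 * (k ^ 2 * u) * c := by linarith
    have := mul_le_mul_of_nonneg_left e3 (by linarith : 0 ≤ l)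
    linarith
  have h2 : 2 * l ^ 2 * (R * (k * (1 + 2 * c))) ≤ 5 * (l ^ 2 * R * k * c) := by
    have e1 : 1 + 2 * c ≤ 5 / 2 * c := by linarith
    have := mul_le_mul_of_nonneg_left e1 (by positivity : 0 ≤ 2 * (l ^ 2 * R * k))
    linarith
  have hlin0 : 0 ≤ l * (16 * (k ^ 2 * u) * c) := by positivity
  have h3 := mul_le_mul h2 h1 (by positivity) (by positivity)
  have hY : 0 ≤ R * c ^ 2 * u := by positivity
  have h4 : 5 * (l ^ 2 * R * k * c) * (l * (16 * (k ^ 2 * u) * c))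
      ≤ 80 * ((R * c ^ 2 * u) * ((l ^ 2) ^ 2 * (k ^ 2) ^ 2)) := by
    have e1 : l ^ 3 * k ^ 3 ≤ (l ^ 2) ^ 2 * (k ^ 2) ^ 2 := by
      rw [← pow_mul, ← pow_mul]
      exact mul_le_mul (pow_le_pow_right₀ hl (by norm_num)) (pow_le_pow_right₀ hk (by norm_num))
        (by positivity) (by positivity)
    have := mul_le_mul_of_nonneg_left e1 hY
    linarith
  have h5 : R * (4 * ((1 + β) * u ^ 2 * c) + 2 * u) ≤ 7 * (R * c ^ 2 * u) := by
    have e1 : (1 + β) * u ^ 2 * c = u ^ 2 * (c + 1) := by linear_combination u ^ 2 * hcβ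
    have e2 : u ^ 2 * (c + 1) ≤ u * (c + 1) := mul_le_mul_of_nonneg_right huu (by linarith)
    have e3 : 4 * (c + 1) + 2 ≤ 7 * c ^ 2 := by nlinarith
    have e4 := mul_le_mul_of_nonneg_left e3 hu0
    rw [e1]
    have e5 : 4 * (u ^ 2 * (c + 1)) + 2 * u ≤ 7 * (c ^ 2 * u) := by linarith
    have := mul_le_mul_of_nonneg_left e5 hR
    linarith
  -- The drift part costs `80` and the reward part `7` of the common monomial, well within `252`.
  -- The powers `l³ k³` and `1` are raised to `l⁴ k⁴`.
  have h6 : (R * c ^ 2 * u) * 1 ≤ (R * c ^ 2 * u) * ((l ^ 2) ^ 2 * (k ^ 2) ^ 2) := by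
    refine mul_le_mul_of_nonneg_left ?_ hY
    exact one_le_mul_of_one_le_of_one_le (one_le_pow₀ hl2) (one_le_pow₀ hk2)
  have h7 : 252 * R * (l ^ 2) ^ 2 * (k ^ 2) ^ 2 * c ^ 2 * u
      = 252 * ((R * c ^ 2 * u) * ((l ^ 2) ^ 2 * (k ^ 2) ^ 2)) := by ring
  have h8 : 0 ≤ (R * c ^ 2 * u) * ((l ^ 2) ^ 2 * (k ^ 2) ^ 2) := by positivity
  rw [h7]
  linarith

variable {S : Type*} [Fintype S] [DecidableEq S] (M : BanditModel S) {y : S → Bool → ℝ} {μ : S → ℝ}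
  {N : ℕ}

/-- The drift of the Lyapunov function and the reward, given the focus set. -/
theorem reward_drift (hy : M.IsLPFeasible y)
    (hchain : IsAperiodicUnichain (M.singleArmMatrix y))
    (hμ : IsStationaryDist (M.singleArmMatrix y) μ) (hN : 0 < N)
    (hint : ∃ b : ℕ, (b : ℝ) = M.α * N) {s : StateVec S N} {D : Finset (Fin N)}
    (hD : D ∈ M.maximalOptimalSets (M.singleArmMatrix y) μ s) :
    (∑ z, ∑ a, M.r z a * y z a
        - 252 * M.rMax * lambdaW (M.singleArmMatrix y) μ ^ 2 * (Fintype.card S : ℝ) ^ 2 / M.β ^ 2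
          * (1 / √N))
      - 2 * lambdaW (M.singleArmMatrix y) μ * (M.rMax * (√(Fintype.card S) * (1 + 2 / M.β)))
        * (M.lyapunov (M.singleArmMatrix y) μ s
          - (idealLaw hy.nonneg s).expect fun ideal => (M.rectifiedLaw D ideal).expect fun a =>
            (M.step s a).expect (M.lyapunov (M.singleArmMatrix y) μ))
      ≤ (idealLaw hy.nonneg s).expect fun ideal => (M.rectifiedLaw D ideal).expect fun a =>
        (1 / (N : ℝ)) * ∑ i, M.r (s i) (a i) := by
  have herg : IsErgodicPair (M.singleArmMatrix y) μ :=
    ⟨M.singleArmMatrix_mem_rowStochastic hy.nonneg, hchain, hμ.1, hμ.2.1⟩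
  have := herg.nonempty
  have hμy := hy.mul_singleArmProb M hchain hμ
  have hα : ∑ z, μ z * singleArmProb y z true = M.α := by
    rw [← hy.budget_eq]
    exact Finset.sum_congr rfl fun z _ => hμy z true
  have hslack := M.slack_nonneg_of_mem_maximalOptimalSets hD
  have hrew := M.expect_reward_ge hy.nonneg hN hint hμ.1 hμ.2.1 hμy hy.budget_eq hslack
  have hnoise := M.expect_l1Norm_stateCount_sub_le hy.nonneg hN hint hμ.2.1 hα hslack
  have hcov := herg.coverage M hN hD
  have hR0 : 0 ≤ M.rMax := Real.iSup_nonneg fun _ => abs_nonneg _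
  have hβ := M.β_pos
  have hl := herg.one_le_lambdaW
  have hnorm := l1Norm_le_weightedNorm herg.stochastic hchain hμ.2.1 (deviation μ s D)
  rw [← hW_eq] at hnorm
  set Q := M.singleArmMatrix y with hQ
  set lam := lambdaW Q μ with hlam
  set V := M.lyapunov Q μ s with hV
  set h := hW Q μ s D with hh
  set k := √(Fintype.card S : ℝ) with hk
  set u := 1 / √(N : ℝ) with hu
  have hk2 : (Fintype.card S : ℝ) = k ^ 2 := (Real.sq_sqrt (Nat.cast_nonneg _)).symm
  have hl2 : lam = √lam ^ 2 := (Real.sq_sqrt (by linarith)).symm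
  have hN1 : (1 : ℝ) ≤ N := by exact_mod_cast hN
  have hu2 : ∀ x : ℝ, x / N = x * u ^ 2 := fun x => by
    rw [hu, div_pow, Real.sq_sqrt (by linarith), one_pow, mul_one_div]
  have hu0 : 0 ≤ u := by positivity
  have hu1 : u ≤ 1 := by
    rw [hu, div_le_one (by positivity)]
    exact Real.one_le_sqrt.2 hN1
  have hk1 : 1 ≤ k := by
    rw [hk, Real.one_le_sqrt]
    exact_mod_cast Fintype.card_pos
  have hl1 : 1 ≤ √lam := Real.one_le_sqrt.2 hl
  have hLip : lipschitzW Q μ = 2 * √lam := rfl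
  set L := (idealLaw hy.nonneg s).expect fun ideal => (M.rectifiedLaw D ideal).expect fun a =>
    (M.step s a).expect (M.lyapunov Q μ) with hL
  set ℓ := (idealLaw hy.nonneg s).expect fun ideal => (M.rectifiedLaw D ideal).expect fun a =>
    (M.step s a).expect fun s' => l1Norm (stateCount s' D - Matrix.vecMul (stateCount s D) Q) with hℓ
  -- the drift, as an affine function of the noise
  let c₁ : ℝ := √lam + 2 * lipschitzW Q μ * (1 / 2 / M.β)
  let c₀ : ℝ := V - 1 / (2 * lam) * h
    + 2 * lipschitzW Q μ * (Fintype.card S / N / M.β + Fintype.card S / N)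
  have hdrift : L ≤ c₁ * ℓ + c₀ := by
    rw [hL, hℓ, ← PMF.expect_const_mul]
    simp only [← PMF.expect_const_mul]
    rw [← PMF.expect_const (idealLaw hy.nonneg s) c₀, ← PMF.expect_add]
    refine PMF.expect_mono _ fun ideal => ?_
    rw [← PMF.expect_const (M.rectifiedLaw D ideal) c₀, ← PMF.expect_add]
    refine PMF.expect_mono _ fun a => ?_
    rw [← PMF.expect_const (M.step s a) c₀, ← PMF.expect_add]
    refine PMF.expect_mono _ fun s' => ?_
    refine (herg.lyapunov_next_le M hμ.2.2 hN hD s' rfl).trans_eq ?_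
    simp only [c₀, c₁]
    ring
  have hc₁ : 0 ≤ c₁ := by
    have := lipschitzW_nonneg (Q := Q) (μ := μ)
    positivity
  have hdrift2 : L ≤ V - 1 / (2 * lam) * h + (√lam * (4 * k * u) + 2 * (2 * √lam) *
      ((1 / 2 * (4 * k * u) + k ^ 2 * u ^ 2) / M.β + k ^ 2 * u ^ 2)) := by
    have h1 := mul_le_mul_of_nonneg_left hnoise hc₁
    refine (hdrift.trans (add_le_add_left h1 _)).trans_eq ?_
    simp only [c₀, c₁, hLip, hu2, hk2]
    ring
  set E := √lam * (4 * k * u) + 2 * (2 * √lam) *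
      ((1 / 2 * (4 * k * u) + k ^ 2 * u ^ 2) / M.β + k ^ 2 * u ^ 2) with hE
  -- The drift inequality solved for `h_W(D)`: it is large only when `V` is expected to decrease.
  have hh2 : h ≤ 2 * lam * (V - L + E) := by
    have h1 : 1 / (2 * lam) * h ≤ V - L + E := by linarith
    rw [one_div_mul_eq_div, div_le_iff₀ (by linarith)] at h1
    linarith
  -- Coverage, with the `ℓ¹` deviation bounded by `√|S| h_W(D)`.
  have hm : 1 - fraction D ≤ k * h / (2 * M.β) + (1 + M.β) * u ^ 2 / M.β := by
    rw [hu2] at hcov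
    have h1 : 1 - fraction D ≤ (1 / 2 * l1Norm (deviation μ s D) + (1 + M.β) * u ^ 2) / M.β := by
      rw [le_div_iff₀ hβ]
      linarith
    refine h1.trans ?_
    have h2 : k * h / (2 * M.β) + (1 + M.β) * u ^ 2 / M.β
        = (1 / 2 * (k * h) + (1 + M.β) * u ^ 2) / M.β := by field_simp
    rw [h2]
    exact div_le_div_of_nonneg_right (by linarith) hβ.le
  have hgap : M.rMax * (l1Norm (deviation μ s D) + 4 * (1 - fraction D) + 2 * u)
      ≤ M.rMax * (k * (1 + 2 / M.β)) * (2 * lam * (V - L + E))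
        + M.rMax * (4 * ((1 + M.β) * u ^ 2 / M.β) + 2 * u) := by
    have h1 : l1Norm (deviation μ s D) + 4 * (1 - fraction D) + 2 * u
        ≤ k * (1 + 2 / M.β) * h + (4 * ((1 + M.β) * u ^ 2 / M.β) + 2 * u) := by
      have h2 : k * (1 + 2 / M.β) * h = k * h + 4 * (k * h / (2 * M.β)) := by field_simp; ring
      rw [h2]
      linarith
    have h3 := mul_le_mul_of_nonneg_left h1 hR0
    have h4 := mul_le_mul_of_nonneg_left hh2
      (by positivity : 0 ≤ M.rMax * (k * (1 + 2 / M.β)))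
    linarith
  have herr := error_bound hu0 hu1 hk1 hl1 hβ M.β_le_half hR0
  rw [← hl2, ← hE, ← hk2] at herr
  have : M.rMax * (k * (1 + 2 / M.β)) * (2 * lam * (V - L + E))
      = 2 * lam * (M.rMax * (k * (1 + 2 / M.β))) * (V - L)
        + 2 * lam * (M.rMax * (k * (1 + 2 / M.β))) * E := by ring
  linarith

/-- Every branch of the rectification pulls exactly the budget, which equals `αN` by integrality.
The policy also witnesses that feasible policies exist, as `optimalReward_le` requires. -/
theorem isFeasible_setOptPolicy (hy : ∀ s a, 0 ≤ y s a) (hint : ∃ b : ℕ, (b : ℝ) = M.α * N)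
    (s₀ : StateVec S N) : M.IsFeasible (M.setOptPolicy y hy μ N) s₀ := by
  intro t p hp
  simp only [stateActionLaw, setOptPolicy, PMF.mem_support_bind_iff, PMF.mem_support_map_iff,
    PMF.mem_support_uniformOfFinset_iff] at hp
  obtain ⟨_, -, a, ⟨D, -, ideal, -, ha⟩, rfl⟩ := hp
  rw [pulls_of_mem_rectified ha, M.budget_eq hint]

end BanditModel

theorem mainTheorem4 {S : Type*} [Fintype S] [DecidableEq S] (M : BanditModel S)
    (y : S → Bool → ℝ) (hy : M.IsLPOptimal y)
    (hchain : IsAperiodicUnichain (M.singleArmMatrix y))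
    (μ : S → ℝ) (hμ : IsStationaryDist (M.singleArmMatrix y) μ)
    (N : ℕ) (hN : 0 < N) (hint : ∃ b : ℕ, (b : ℝ) = M.α * N) :
    M.IsMarkovChainUnder (fun s : StateVec S N => stateCount s Finset.univ)
        (M.setOptPolicy y hy.feasible.nonneg μ N) ∧
      ∀ s₀ : StateVec S N, ∃ R : ℝ,
        Tendsto (fun T : ℕ => M.averageReward (M.setOptPolicy y hy.feasible.nonneg μ N) s₀ T)
          atTop (𝓝 R) ∧
        M.optimalReward s₀ - R ≤
          252 * M.rMax * lambdaW (M.singleArmMatrix y) μ ^ 2 * (Fintype.card S : ℝ) ^ 2 / M.β ^ 2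
            * (1 / Real.sqrt N) := by
  refine ⟨M.isMarkovChainUnder_setOptPolicy y hy.feasible.nonneg μ, fun s₀ => ?_⟩
  -- The policy ignores its history argument, so the empty history determines it.
  let q := M.setOptPolicy y hy.feasible.nonneg μ N []
  have hq : ∀ s (f : ActionVec N → ℝ), (q s).expect f
      = (PMF.uniformOfFinset (M.maximalOptimalSets (M.singleArmMatrix y) μ s)
          (M.maximalOptimalSets_nonempty _ μ s)).expect fun D =>
        (BanditModel.idealLaw hy.feasible.nonneg s).expect fun ideal =>
          (M.rectifiedLaw D ideal).expect f := fun s f => by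
    simp only [q, BanditModel.setOptPolicy, PMF.expect_bind, BanditModel.idealLaw,
      BanditModel.rectifiedLaw]
  obtain ⟨R, hR, hge⟩ := exists_tendsto_average_expect
    (κ := M.stationaryKernel q)
    (law := fun t => (M.historyLaw (fun _ => q) s₀ t).map Prod.snd) (x := s₀)
    (by simp [BanditModel.historyLaw, PMF.pure_map]) (M.historyLaw_stationary_succ q s₀)
    (fun s => (q s).expect fun a => (1 / (N : ℝ)) * ∑ i, M.r (s i) (a i))
    (M.lyapunov (M.singleArmMatrix y) μ)
    (b := 2 * lambdaW (M.singleArmMatrix y) μ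
      * (M.rMax * (√(Fintype.card S) * (1 + 2 / M.β))))
    (c := ∑ z, ∑ a, M.r z a * y z a
        - 252 * M.rMax * lambdaW (M.singleArmMatrix y) μ ^ 2 * (Fintype.card S : ℝ) ^ 2 / M.β ^ 2
          * (1 / √N))
    (fun s => by
      rw [BanditModel.stationaryKernel, PMF.expect_bind, hq, hq]
      -- The one-step inequality holds for every maximal optimal set, with the same `V`, and can be
      -- averaged over the random focus set.
      have h := PMF.expect_mono_support (PMF.uniformOfFinset
        (M.maximalOptimalSets (M.singleArmMatrix y) μ s) (M.maximalOptimalSets_nonempty _ μ s))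
        fun D hD => M.reward_drift hy.feasible hchain hμ hN hint
          ((PMF.mem_support_uniformOfFinset_iff _ _).1 hD)
      rwa [PMF.expect_sub, PMF.expect_const, PMF.expect_const_mul, PMF.expect_sub,
        PMF.expect_const] at h)
  refine ⟨R, hR.congr fun T => (M.averageReward_stationary q s₀ T).symm, ?_⟩
  have hopt := M.optimalReward_le hN
    (M.isFeasible_setOptPolicy (μ := μ) hy.feasible.nonneg hint s₀) hy
  linarith
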